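/- Let $d\ge 2$ be an integer and let $(p_n)_{n\ge 1}$ be a sequence in $[0,1]$. Let $Y_1,Y_2,\dots$ be the inhomogeneous Markov chain on the $2d$ unit vectors $\pm \mathrm e_1,\dots,\pm \mathrm e_d$ of $\mathbb Z^d$ for which $Y_1$ is uniform and, for all $n\ge 1$ and all unit vectors $u,v$, $$\mathbb P(Y_{n+1}=v\mid Y_n=u)=(1-p_n)\,\mathbf 1_{\{u=v\}}+\frac{p_n}{2d},$$ and let $S_n=Y_1+\dots+Y_n$. Assume that for some $\varepsilon>\varepsilon'>0$ and $r>1$ $$\limsup_{n\to\infty}\frac{\max_{k\in[0,n^{1-\varepsilon'}]}p_{n-k}}{\min_{k\in[0,n^{1-\varepsilon'}]}p_{n-k}}<r,\qquad \lim_{n\to\infty}\frac{p_n\,n^{1-\varepsilon}}{\ln n}=\infty,\qquad \sum_{n=1}^\infty\left(\frac{p_n}{n^{1-\varepsilon}}\right)^{d/2}<\infty,$$ where $k$ runs over the integers. Then $\sum_{n=1}^\infty\mathbb P(S_n=w)<\infty$ for every $w\in\mathbb Z^d$, and the walk $S$ is strongly transient, that is, $\mathbb P(\lim_{n\to\infty}|S_n|=\infty)=1$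 (with the Euclidean norm). In particular, suppose that $p_n=(c+o(1))/n^{\gamma}$ with $c>0$ and $\gamma\in(0,1)$. Then the three conditions hold for all $0<\varepsilon'<\varepsilon<\min\{\gamma,1-\gamma\}$ and $r>1$; hence $\sum_{n=1}^\infty\mathbb P(S_n=w)<\infty$ for every $w\in\mathbb Z^d$, and $S$ is strongly transient. -/

import Mathlib

open Filter Topology MeasureTheory
open scoped ENNReal

noncomputable section

/-- The `2d` unit steps `±e₁, …, ±e_d` of the lattice `ℤ^d`. -/
def unitSteps (d : ℕ) : Set (Fin d → ℤ) :=
  {v | ∃ i : Fin d, v = Pi.single i 1 ∨ v = Pi.single i (-1)}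

open Classical in
/-- Entry `(u, v)` of the transition matrix `(1 - q) I + (q / (2d)) A` on the `2d` unit steps, where
`I` is the identity and `A` the all-ones matrix: with probability `q` the direction is updated, and
then the new direction is uniform among the `2d` unit steps. -/
def stepTransition (d : ℕ) (q : ℝ) (u v : Fin d → ℤ) : ℝ :=
  (1 - q) * (if u = v then 1 else 0) + q / (2 * (d : ℝ))

/-- `Y 1, Y 2, …` (the value `Y 0` is not used) is a time-inhomogeneous Markov chain on the unit
steps of `ℤ^d`, with `Y 1` uniform, and with transition matrix `stepTransition d (p n)` between the
times `n` and `n + 1`. -/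
structure IsConservativeStepChain (d : ℕ) (p : ℕ → ℝ) {Ω : Type*} [MeasurableSpace Ω]
    (P : Measure Ω) (Y : ℕ → Ω → (Fin d → ℤ)) : Prop where
  measurable : ∀ n, 1 ≤ n → Measurable (Y n)
  mem_unitSteps : ∀ n, 1 ≤ n → ∀ᵐ ω ∂P, Y n ω ∈ unitSteps d
  initial : ∀ v ∈ unitSteps d, P.real {ω | Y 1 ω = v} = 1 / (2 * (d : ℝ))
  markov : ∀ n, 1 ≤ n → ∀ y : ℕ → (Fin d → ℤ),
    (∀ k ∈ Finset.Icc 1 (n + 1), y k ∈ unitSteps d) →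
    P.real {ω | ∀ k ∈ Finset.Icc 1 (n + 1), Y k ω = y k} =
      P.real {ω | ∀ k ∈ Finset.Icc 1 n, Y k ω = y k} * stepTransition d (p n) (y n) (y (n + 1))

/-- The walk `S_n = Y_1 + ⋯ + Y_n` started at the origin. -/
def conservativeWalk {d : ℕ} {Ω : Type*} (Y : ℕ → Ω → (Fin d → ℤ)) (n : ℕ) (ω : Ω) :
    Fin d → ℤ :=
  ∑ k ∈ Finset.Icc 1 n, Y k ω

/-- The Euclidean norm of a lattice point. -/
def latticeNorm {d : ℕ} (x : Fin d → ℤ) : ℝ :=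
  ‖(WithLp.toLp 2 (fun i => (x i : ℝ)) : EuclideanSpace ℝ (Fin d))‖

/-- Almost surely `|S_n| → ∞`. -/
def StronglyTransient {d : ℕ} {Ω : Type*} [MeasurableSpace Ω] (P : Measure Ω)
    (S : ℕ → Ω → (Fin d → ℤ)) : Prop :=
  ∀ᵐ ω ∂P, Tendsto (fun n => latticeNorm (S n ω)) atTop atTop

/-- `max {p (n - k) : k integer, 0 ≤ k ≤ n ^ a}`; it is used with `a ≤ 1`, so that `k ≤ n` for
all `n ≥ 1`. -/
def windowMax (p : ℕ → ℝ) (a : ℝ) (n : ℕ) : ℝ :=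
  (Finset.range (⌊(n : ℝ) ^ a⌋₊ + 1)).sup' Finset.nonempty_range_add_one (fun k => p (n - k))

/-- `min {p (n - k) : k integer, 0 ≤ k ≤ n ^ a}`. -/
def windowMin (p : ℕ → ℝ) (a : ℝ) (n : ℕ) : ℝ :=
  (Finset.range (⌊(n : ℝ) ^ a⌋₊ + 1)).inf' Finset.nonempty_range_add_one (fun k => p (n - k))

/-- The three conditions on the update probabilities. The limsup is taken in `[0, ∞]`, where it
always makes sense; the second condition makes `windowMin` positive for all large `n`. -/
structure UpdateConditions (d : ℕ) (p : ℕ → ℝ) (ε ε' r : ℝ) : Prop where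
  roughly_constant :
    limsup (fun n : ℕ => ENNReal.ofReal (windowMax p (1 - ε') n) /
      ENNReal.ofReal (windowMin p (1 - ε') n)) atTop < ENNReal.ofReal r
  not_too_small :
    Tendsto (fun n : ℕ => p n * (n : ℝ) ^ (1 - ε) / Real.log n) atTop atTop
  summable :
    Summable (fun n : ℕ => (p (n + 1) / ((n + 1 : ℕ) : ℝ) ^ (1 - ε)) ^ ((d : ℝ) / 2))

end

/-! For a frequency θ, split the Fourier transform of the law of the walk according to the last
step; this gives a vector in ℂ^{2d}. One step of the chain acts on it by `partialUpdate`, which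
fixes the normalized constant vector e and damps its orthogonal complement by 1 - p n, followed by a
diagonal isometry U = `twist θ` (`charVec_succ`). Neither factor alone decreases the norm of every
vector: the damping does not see the mean ⟨e, f⟩, and U preserves norms. Together they do, because U
moves the mean into the damped complement with amplitude ρ, where φ = ⟨e, U e⟩ and ρ² = 1 - φ².

This is a hypocoercivity argument: ‖f‖² is corrected by a small quadratic term so that the result
shrinks in each step by a relative amount of order qρ²/(q² + ρ²) (`exists_lyapunov`). The corrected
function depends on q and r but not on the current update rate in [q, rq], so it serves a whole
window of comparable rates. Before the window, contractivity is enough.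

The rate is at least q/2 or ρ²/(2q), according to whether ρ² exceeds q². The second bound
degenerates only at φ = ±1, where it is integrated as a Gaussian. A window of length m thus gives
P(S_n = w) ≤ C(exp(-cmq) + (q/m)^{d/2}) (`exists_measureReal_walk_le`). With m = ⌊n^{1-ε'}⌋ and q
the window minimum, the second condition makes the exponential at most n⁻² and the third sums the
power. Borel–Cantelli at each lattice point then gives transience. -/

/-- The contraction that keeps the component along the unit vector `e` and shrinks the orthogonal
component by the factor `1 - s`. -/
noncomputable def partialUpdate {H : Type*} [NormedAddCommGroup H] [InnerProductSpace ℂ H] (e : H) (s : ℝ)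
    (f : H) : H :=
  inner ℂ e f • e + ((1 - s : ℝ) : ℂ) • (f - inner ℂ e f • e)

/-! ### Hypocoercive decay for a partial damping composed with an isometry. -/

section Lyapunov

variable {H : Type*} [NormedAddCommGroup H] [InnerProductSpace ℂ H]

lemma inner_sub_proj {e : H} (he : ‖e‖ = 1) (f : H) : inner ℂ e (f - inner ℂ e f • e) = 0 := by
  rw [inner_sub_right, inner_smul_right, inner_self_eq_norm_sq_to_K, he]
  simp

lemma norm_sq_smul_add_of_inner_eq_zero {e : H} (he : ‖e‖ = 1) {g : H} (hg : inner ℂ e g = 0)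
    (a : ℂ) : ‖a • e + g‖ ^ 2 = ‖a‖ ^ 2 + ‖g‖ ^ 2 := by
  have h := norm_add_sq_eq_norm_sq_add_norm_sq_of_inner_eq_zero (𝕜 := ℂ) (a • e) g
    (by rw [inner_smul_left, hg, mul_zero])
  rw [norm_smul, he, mul_one] at h
  nlinarith [h]

lemma norm_sq_eq_proj_add {e : H} (he : ‖e‖ = 1) (f : H) :
    ‖f‖ ^ 2 = ‖inner ℂ e f‖ ^ 2 + ‖f - inner ℂ e f • e‖ ^ 2 := by
  have h := norm_sq_smul_add_of_inner_eq_zero he (inner_sub_proj he f) (inner ℂ e f)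
  rwa [add_sub_cancel] at h

lemma norm_sq_partialUpdate {e : H} (he : ‖e‖ = 1) (s : ℝ) (f : H) :
    ‖partialUpdate e s f‖ ^ 2 =
      ‖inner ℂ e f‖ ^ 2 + (1 - s) ^ 2 * ‖f - inner ℂ e f • e‖ ^ 2 := by
  have h := norm_sq_smul_add_of_inner_eq_zero he
    (g := ((1 - s : ℝ) : ℂ) • (f - inner ℂ e f • e))
    (by rw [inner_smul_right, inner_sub_proj he, mul_zero]) (inner ℂ e f)
  rw [partialUpdate, h, norm_smul, mul_pow, Complex.norm_real, Real.norm_eq_abs, sq_abs]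

lemma norm_partialUpdate_le {e : H} (he : ‖e‖ = 1) {s : ℝ} (h0 : 0 ≤ s) (h1 : s ≤ 1) (f : H) :
    ‖partialUpdate e s f‖ ≤ ‖f‖ := by
  have h := norm_sq_partialUpdate he s f
  have h' := norm_sq_eq_proj_add he f
  refine (sq_le_sq₀ (norm_nonneg _) (norm_nonneg _)).1 ?_
  rw [h, h']
  nlinarith [sq_nonneg ‖f - inner ℂ e f • e‖, mul_nonneg h0 (sub_nonneg.2 h1),
    mul_nonneg (mul_nonneg h0 (by linarith : (0 : ℝ) ≤ 2 - s)) (sq_nonneg ‖f - inner ℂ e f • e‖)]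

/-- The interaction between the mean part of `f` and its fluctuation in the direction `h`. -/
noncomputable def crossTerm (e h f : H) : ℝ :=
  (starRingEnd ℂ (inner ℂ e f) * inner ℂ h f).re

lemma abs_re_conj_mul_le {z w : ℂ} {a b : ℝ} (hz : ‖z‖ ≤ a) (hw : ‖w‖ ≤ b) :
    |(starRingEnd ℂ z * w).re| ≤ a * b := by
  refine (Complex.abs_re_le_norm _).trans ?_
  rw [norm_mul, RCLike.norm_conj]
  exact mul_le_mul hz hw (norm_nonneg _) ((norm_nonneg _).trans hz)

/-- Gain of the cross term in one step, as an inequality between real numbers. -/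
lemma crossTerm_gain_real {φ ρ K s A G X x y z w : ℝ} (hφ : φ ^ 2 + ρ ^ 2 = 1) (hρ : 0 ≤ ρ)
    (hs0 : 0 ≤ s) (hs1 : s ≤ 1) (hA : 0 ≤ A) (hG : 0 ≤ G)
    (hX : |X| ≤ A * (ρ * G)) (hx : |x| ≤ A * (ρ * (K * ρ * G))) (hy : |y| ≤ (K * ρ * G) * A)
    (hz : |z| ≤ (K * ρ * G) * (ρ * G)) (hw : |w| ≤ (K * ρ * G) * (ρ * (K * ρ * G))) :
    φ ^ 2 * ρ ^ 2 * A ^ 2 - s * ρ * A * G - (2 * K + 1) * ρ ^ 2 * A * G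
        - (K + K ^ 2) * ρ ^ 2 * G ^ 2 ≤
      φ * (φ * ρ ^ 2 * A ^ 2 + (1 - s) * φ ^ 2 * X + (1 - s) * φ * x + (1 - s) * ρ ^ 2 * y
        + (1 - s) ^ 2 * (φ * z + w)) - φ * X := by
  have hρ1 : ρ ≤ 1 := by nlinarith [sq_nonneg φ]
  have hφ1 : |φ| ≤ 1 := abs_le_one_iff_mul_self_le_one.2 (by nlinarith)
  have ht0 : 0 ≤ 1 - s := by linarith
  have ht1 : |1 - s| ≤ 1 := abs_le.2 ⟨by linarith, by linarith⟩
  have hρa : |ρ| ≤ 1 := abs_le.2 ⟨by linarith, hρ1⟩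
  have key : ∀ {u v b : ℝ}, |u| ≤ 1 → |v| ≤ b → -b ≤ u * v := by
    intro u v b hu hv
    have : |u * v| ≤ b := by
      rw [abs_mul]
      exact (mul_le_of_le_one_left (abs_nonneg _) hu).trans hv
    exact (abs_le.1 this).1
  have mul1 : ∀ {u v : ℝ}, |u| ≤ 1 → |v| ≤ 1 → |u * v| ≤ 1 := fun hu hv => by
    rw [abs_mul]; exact mul_le_one₀ hu (abs_nonneg _) hv
  -- The old cross term X nearly cancels: its net coefficient (1 - s)φ² - 1 has size at most s + ρ²,
  -- because 1 - φ² = ρ².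
  have e1 : -((s + ρ ^ 2) * (A * (ρ * G))) ≤ (φ * ((1 - s) * φ ^ 2 - 1)) * X := by
    have h1 : |((1 - s) * φ ^ 2 - 1) * X| ≤ (s + ρ ^ 2) * (A * (ρ * G)) := by
      rw [abs_mul]
      refine mul_le_mul ?_ hX (abs_nonneg _) (by positivity)
      rw [abs_le]
      constructor <;> nlinarith [mul_nonneg hs0 (sq_nonneg ρ), mul_nonneg ht0 (sq_nonneg φ)]
    have := key hφ1 h1
    linarith
  have e2 := key (mul1 (mul1 ht1 hφ1) hφ1) hx
  have e3 := key (mul1 (mul1 ht1 hφ1) hρa) (v := ρ * y) (b := ρ * ((K * ρ * G) * A)) (by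
    rw [abs_mul, abs_of_nonneg hρ]; exact mul_le_mul_of_nonneg_left hy hρ)
  have e4 := key (mul1 (mul1 (mul1 ht1 ht1) hφ1) hφ1) hz
  have e5 := key (mul1 (mul1 ht1 ht1) hφ1) hw
  have b1 : ρ ^ 3 * (A * G) ≤ ρ ^ 2 * (A * G) :=
    mul_le_mul_of_nonneg_right (by nlinarith [sq_nonneg ρ]) (by positivity)
  have b2 : K ^ 2 * ρ ^ 3 * G ^ 2 ≤ K ^ 2 * ρ ^ 2 * G ^ 2 :=
    mul_le_mul_of_nonneg_right
      (mul_le_mul_of_nonneg_left (by nlinarith [sq_nonneg ρ]) (by positivity)) (by positivity)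
  nlinarith

lemma one_sub_sq_mul_sq_le {q s : ℝ} (hs0 : 0 ≤ s) (hqs : q ≤ s) (hs1 : s ≤ 1) (G : ℝ) :
    (1 - s) ^ 2 * G ^ 2 ≤ G ^ 2 - q * G ^ 2 := by
  have h : (1 - s) ^ 2 ≤ 1 - q := by nlinarith
  nlinarith [mul_le_mul_of_nonneg_right h (sq_nonneg G)]

/-- Absorption of the error terms of the cross term into the mean and the fluctuation. -/
lemma crossTerm_gain_absorb {φ ρ K r q s A G D : ℝ} (hK : 0 ≤ K) (hs0 : 0 ≤ s) (hsr : s ≤ r * q)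
    (hhalf : 1 / 2 ≤ φ ^ 2)
    (hcross : φ ^ 2 * ρ ^ 2 * A ^ 2 - s * ρ * A * G - (2 * K + 1) * ρ ^ 2 * A * G
        - (K + K ^ 2) * ρ ^ 2 * G ^ 2 ≤ D) :
    ρ ^ 2 * A ^ 2 / 4 -
      (2 * r ^ 2 + 2 * (2 * K + 1) ^ 2 + K + K ^ 2) * (q ^ 2 + ρ ^ 2) * G ^ 2 ≤ D := by
  -- The gain is at least ρ²A²/2. Each of the two mixed products AG is allowed ρ²A²/8 of it, which
  -- fixes the weight 4 in the squares and leaves ρ²A²/4.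
  have g1 : s * ρ * A * G ≤ ρ ^ 2 * A ^ 2 / 8 + 2 * s ^ 2 * G ^ 2 := by
    nlinarith [sq_nonneg (ρ * A - 4 * (s * G))]
  have g2 : (2 * K + 1) * ρ ^ 2 * A * G ≤
      ρ ^ 2 * A ^ 2 / 8 + 2 * (2 * K + 1) ^ 2 * ρ ^ 2 * G ^ 2 := by
    nlinarith [sq_nonneg (ρ * (A - 4 * ((2 * K + 1) * G)))]
  have g3 : 2 * s ^ 2 * G ^ 2 ≤ 2 * r ^ 2 * q ^ 2 * G ^ 2 := by
    have : s ^ 2 ≤ (r * q) ^ 2 := pow_le_pow_left₀ hs0 hsr 2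
    nlinarith [sq_nonneg G]
  have g4 : 1 / 2 * (ρ ^ 2 * A ^ 2) ≤ φ ^ 2 * (ρ ^ 2 * A ^ 2) :=
    mul_le_mul_of_nonneg_right hhalf (by positivity)
  have g5 : 0 ≤ 2 * r ^ 2 * ρ ^ 2 * G ^ 2 := by positivity
  have g6 : 0 ≤ (2 * (2 * K + 1) ^ 2 + K + K ^ 2) * q ^ 2 * G ^ 2 := by positivity
  linarith

variable {e : H} {U : H →ₗᵢ[ℂ] H} {φ ρ K : ℝ}

lemma norm_sq_image_sub (he : ‖e‖ = 1) (hφ : inner ℂ e (U e) = (φ : ℂ))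
    (hρ : φ ^ 2 + ρ ^ 2 = 1) : ‖U e - (φ : ℂ) • e‖ ^ 2 = ρ ^ 2 := by
  have h := norm_sq_eq_proj_add he (U e)
  rw [hφ, U.norm_map, he, Complex.norm_real, Real.norm_eq_abs, sq_abs] at h
  linarith

/-- With f = a e + g and h = U e - φ e, the mean a e is mapped to aφ e + a h. Pairing with e and h
creates the positive term φ²ρ²|a|²; every other contribution involves g and is an error controlled
by s, ρ and ‖U g - φ g‖ ≤ Kρ‖g‖. -/
lemma crossTerm_step (he : ‖e‖ = 1) (hφ : inner ℂ e (U e) = (φ : ℂ)) (hρ0 : 0 ≤ ρ)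
    (hρ : φ ^ 2 + ρ ^ 2 = 1) (hU : ∀ x, ‖U x - (φ : ℂ) • x‖ ≤ K * ρ * ‖x‖)
    {s : ℝ} (hs0 : 0 ≤ s) (hs1 : s ≤ 1) (f : H) :
    φ ^ 2 * ρ ^ 2 * ‖inner ℂ e f‖ ^ 2
        - s * ρ * ‖inner ℂ e f‖ * ‖f - inner ℂ e f • e‖
        - (2 * K + 1) * ρ ^ 2 * ‖inner ℂ e f‖ * ‖f - inner ℂ e f • e‖
        - (K + K ^ 2) * ρ ^ 2 * ‖f - inner ℂ e f • e‖ ^ 2 ≤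
      φ * crossTerm e (U e - (φ : ℂ) • e) (U (partialUpdate e s f))
        - φ * crossTerm e (U e - (φ : ℂ) • e) f := by
  set h := U e - (φ : ℂ) • e with hh
  set a := inner ℂ e f with ha
  set g := f - a • e with hg
  set B := U g - (φ : ℂ) • g with hB
  have heg : inner ℂ e g = 0 := inner_sub_proj he f
  have hee : inner ℂ e e = (1 : ℂ) := by rw [inner_self_eq_norm_sq_to_K, he]; simp
  have hhn2 : ‖h‖ ^ 2 = ρ ^ 2 := norm_sq_image_sub he hφ hρ
  have hhn : ‖h‖ = ρ := (sq_eq_sq₀ (norm_nonneg _) hρ0).1 hhn2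
  have heh : inner ℂ e h = 0 := by
    rw [hh, inner_sub_right, inner_smul_right, hee, hφ, mul_one, sub_self]
  have hhe : inner ℂ h e = 0 := by rw [← inner_conj_symm, heh, map_zero]
  have hhh : inner ℂ h h = ((ρ ^ 2 : ℝ) : ℂ) := by
    rw [inner_self_eq_norm_sq_to_K, hhn]; simp
  have hhf : inner ℂ h f = inner ℂ h g := by
    rw [hg, inner_sub_right, inner_smul_right, hhe, mul_zero, sub_zero]
  have hstep : U (partialUpdate e s f) =
      (a * φ) • e + a • h + (((1 - s : ℝ) : ℂ) * φ) • g + ((1 - s : ℝ) : ℂ) • B := by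
    rw [partialUpdate, ← ha, ← hg, map_add, map_smul, map_smul, hB, hh]
    module
  have hinner_e : inner ℂ e (U (partialUpdate e s f)) =
      a * φ + ((1 - s : ℝ) : ℂ) * inner ℂ e B := by
    rw [hstep]
    simp only [inner_add_right, inner_smul_right, hee, heh, heg]
    ring
  have hinner_h : inner ℂ h (U (partialUpdate e s f)) =
      a * ((ρ ^ 2 : ℝ) : ℂ) + ((1 - s : ℝ) : ℂ) * φ * inner ℂ h g
        + ((1 - s : ℝ) : ℂ) * inner ℂ h B := by
    rw [hstep]
    simp only [inner_add_right, inner_smul_right, hhe, hhh]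
    ring
  have hBn : ‖B‖ ≤ K * ρ * ‖g‖ := hU g
  have hβ : ‖inner ℂ e B‖ ≤ K * ρ * ‖g‖ := by
    refine (norm_inner_le_norm e B).trans ?_
    rwa [he, one_mul]
  have hχ : ‖inner ℂ h g‖ ≤ ρ * ‖g‖ := by
    refine (norm_inner_le_norm h g).trans ?_
    rw [hhn]
  have hη : ‖inner ℂ h B‖ ≤ ρ * (K * ρ * ‖g‖) := by
    refine (norm_inner_le_norm h B).trans ?_
    rw [hhn]
    exact mul_le_mul_of_nonneg_left hBn hρ0
  have hmain := crossTerm_gain_real hρ hρ0 hs0 hs1 (norm_nonneg a) (norm_nonneg g)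
    (abs_re_conj_mul_le le_rfl hχ) (abs_re_conj_mul_le le_rfl hη)
    (abs_re_conj_mul_le hβ (le_refl ‖a‖)) (abs_re_conj_mul_le hβ hχ) (abs_re_conj_mul_le hβ hη)
  refine hmain.trans (le_of_eq ?_)
  rw [crossTerm, crossTerm, hinner_e, hinner_h, ← ha, hhf]
  have hna : ‖a‖ ^ 2 = a.re ^ 2 + a.im ^ 2 := by
    rw [Complex.sq_norm, Complex.normSq_apply]; ring
  rw [hna]
  simp only [map_add, map_mul, Complex.conj_ofReal, Complex.mul_re, Complex.mul_im, Complex.add_re,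
    Complex.add_im, Complex.conj_re, Complex.conj_im, Complex.ofReal_re, Complex.ofReal_im]
  ring

/-- Cauchy–Schwarz twice, with ‖U e - φ e‖ = ρ. It keeps the corrected functional comparable to ‖f‖²
as soon as its coefficient δ satisfies δρ ≤ 1/2. -/
lemma abs_mul_crossTerm_le (he : ‖e‖ = 1) (hφ : inner ℂ e (U e) = (φ : ℂ)) (hρ0 : 0 ≤ ρ)
    (hρ : φ ^ 2 + ρ ^ 2 = 1) (f : H) :
    |φ * crossTerm e (U e - (φ : ℂ) • e) f| ≤ ρ * ‖f‖ ^ 2 := by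
  have hφ1 : |φ| ≤ 1 := abs_le_one_iff_mul_self_le_one.2 (by nlinarith)
  have hhn : ‖U e - (φ : ℂ) • e‖ = ρ :=
    (sq_eq_sq₀ (norm_nonneg _) hρ0).1 (norm_sq_image_sub he hφ hρ)
  have h1 : ‖inner ℂ e f‖ ≤ ‖f‖ := by
    simpa [he] using norm_inner_le_norm (𝕜 := ℂ) e f
  have h2 : ‖inner ℂ (U e - (φ : ℂ) • e) f‖ ≤ ρ * ‖f‖ := by
    rw [← hhn]; exact norm_inner_le_norm _ f
  have h3 := abs_re_conj_mul_le h1 h2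
  rw [abs_mul]
  refine (mul_le_of_le_one_left (abs_nonneg _) hφ1).trans (h3.trans (le_of_eq ?_))
  ring

/-- The constant in the exponential decay rate of the Lyapunov function. -/
noncomputable def decayConst (K r : ℝ) : ℝ := 1 / (16 * (2 * r ^ 2 + 2 * (2 * K + 1) ^ 2 + K + K ^ 2))

lemma decayConst_pos {K r : ℝ} (hK : 0 ≤ K) : 0 < decayConst K r := by
  unfold decayConst; positivity

/-- A Lyapunov function when the mean of the rotation is bounded away from zero. -/
lemma exists_lyapunov_of_half_le (he : ‖e‖ = 1) (hφ : inner ℂ e (U e) = (φ : ℂ)) (hρ0 : 0 ≤ ρ)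
    (hρ : φ ^ 2 + ρ ^ 2 = 1) (hK : 0 ≤ K) (hU : ∀ x, ‖U x - (φ : ℂ) • x‖ ≤ K * ρ * ‖x‖)
    {q r : ℝ} (hq : 0 < q) (hhalf : 1 / 2 ≤ φ ^ 2) :
    ∃ E : H → ℝ, (∀ f, ‖f‖ ^ 2 ≤ 2 * E f ∧ E f ≤ 2 * ‖f‖ ^ 2) ∧
      ∀ s, q ≤ s → s ≤ r * q → s ≤ 1 → ∀ f, E (U (partialUpdate e s f)) ≤
        (1 - decayConst K r * (q * ρ ^ 2 / (q ^ 2 + ρ ^ 2))) * E f := by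
  set M : ℝ := 2 * r ^ 2 + 2 * (2 * K + 1) ^ 2 + K + K ^ 2 with hM
  have hM2 : 2 ≤ M := by nlinarith [sq_nonneg r, sq_nonneg K]
  have hden : 0 < q ^ 2 + ρ ^ 2 := by positivity
  -- δ is tuned so that the cross term costs exactly q/2 times the squared fluctuation, half of what
  -- the damping removes.
  set δ : ℝ := q / (q ^ 2 + ρ ^ 2) / (2 * M) with hδ
  have hδ0 : 0 ≤ δ := by positivity
  have hδM : δ * (M * (q ^ 2 + ρ ^ 2)) = q / 2 := by
    rw [hδ]; field_simp
  have hδρ : δ * ρ ≤ 1 / 2 := by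
    have h1 : δ * ρ = q * ρ / (q ^ 2 + ρ ^ 2) / (2 * M) := by rw [hδ]; ring
    rw [h1, div_le_iff₀ (by positivity), div_le_iff₀ hden]
    nlinarith [sq_nonneg (q - ρ), mul_pos hq hq, sq_nonneg ρ]
  set lam : ℝ := q * ρ ^ 2 / (q ^ 2 + ρ ^ 2) with hlam
  have hlam0 : 0 ≤ lam := by positivity
  have hlamq : lam ≤ q := by
    rw [hlam, div_le_iff₀ hden]; nlinarith [pow_pos hq 3]
  have hδlam : δ * ρ ^ 2 = lam / (2 * M) := by rw [hδ, hlam]; ring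
  have hc : decayConst K r = 1 / (16 * M) := rfl
  have hE : ∀ f : H, ‖f‖ ^ 2 ≤ 2 * (‖f‖ ^ 2 - δ * (φ * crossTerm e (U e - (φ : ℂ) • e) f)) ∧
      ‖f‖ ^ 2 - δ * (φ * crossTerm e (U e - (φ : ℂ) • e) f) ≤ 2 * ‖f‖ ^ 2 := by
    intro f
    have h := abs_mul_crossTerm_le he hφ hρ0 hρ f
    have h' : |δ * (φ * crossTerm e (U e - (φ : ℂ) • e) f)| ≤ ‖f‖ ^ 2 / 2 := by
      rw [abs_mul, abs_of_nonneg hδ0]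
      calc _ ≤ δ * (ρ * ‖f‖ ^ 2) := mul_le_mul_of_nonneg_left h hδ0
        _ = δ * ρ * ‖f‖ ^ 2 := by ring
        _ ≤ 1 / 2 * ‖f‖ ^ 2 := mul_le_mul_of_nonneg_right hδρ (sq_nonneg _)
        _ = ‖f‖ ^ 2 / 2 := by ring
    have := abs_le.1 h'
    constructor <;> nlinarith [sq_nonneg ‖f‖]
  -- The cross term grows while a mean is present, so subtracting it yields decay in the direction
  -- that the damping misses.
  refine ⟨fun f => ‖f‖ ^ 2 - δ * (φ * crossTerm e (U e - (φ : ℂ) • e) f), hE, ?_⟩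
  intro s hqs hsr hs1 f
  have hs0 : 0 ≤ s := hq.le.trans hqs
  have hcross := crossTerm_step he hφ hρ0 hρ hU hs0 hs1 f
  have hEf := (hE f).2
  have hnorm := norm_sq_eq_proj_add he f
  have hnorm' := norm_sq_partialUpdate he s f
  rw [← U.norm_map] at hnorm'
  beta_reduce
  set E0 := ‖f‖ ^ 2 - δ * (φ * crossTerm e (U e - (φ : ℂ) • e) f) with hE0
  generalize crossTerm e (U e - (φ : ℂ) • e) (U (partialUpdate e s f)) = X' at *
  generalize crossTerm e (U e - (φ : ℂ) • e) f = X at *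
  generalize hAA : ‖inner ℂ e f‖ = A at *
  generalize hGG : ‖f - inner ℂ e f • e‖ = G at *
  have hA : 0 ≤ A := hAA ▸ norm_nonneg _
  have hG : 0 ≤ G := hGG ▸ norm_nonneg _
  have g5 : ρ ^ 2 * A ^ 2 / 4 - M * (q ^ 2 + ρ ^ 2) * G ^ 2 ≤ φ * X' - φ * X :=
    crossTerm_gain_absorb hK hs0 hsr hhalf hcross
  have g6 : lam / (2 * M) * A ^ 2 / 4 - q / 2 * G ^ 2 ≤ δ * (φ * X') - δ * (φ * X) := by
    have := mul_le_mul_of_nonneg_left g5 hδ0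
    rw [← hδlam, ← hδM]
    linarith
  have g7 : (1 - s) ^ 2 * G ^ 2 ≤ G ^ 2 - q * G ^ 2 :=
    one_sub_sq_mul_sq_le hs0 hqs hs1 G
  have g8 : lam / (8 * M) * G ^ 2 ≤ q / 2 * G ^ 2 := by
    refine mul_le_mul_of_nonneg_right ?_ (sq_nonneg G)
    rw [div_le_iff₀ (by positivity)]
    have : q * 1 ≤ q * (4 * M) := mul_le_mul_of_nonneg_left (by linarith) hq.le
    linarith
  -- Mean and fluctuation both lose the fraction lam/(8M); the bound E ≤ 2‖f‖² turns this into the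
  -- 1/(16M) of `decayConst`.
  have g9 : ‖U (partialUpdate e s f)‖ ^ 2 - δ * (φ * X') ≤ E0 - lam / (8 * M) * ‖f‖ ^ 2 := by
    have : lam / (2 * M) * A ^ 2 / 4 = lam / (8 * M) * A ^ 2 := by ring
    rw [hnorm', hE0, hnorm]
    linarith
  have g10 : lam / (16 * M) * E0 ≤ lam / (8 * M) * ‖f‖ ^ 2 := by
    have : lam / (8 * M) * ‖f‖ ^ 2 = lam / (16 * M) * (2 * ‖f‖ ^ 2) := by ring
    rw [this]
    exact mul_le_mul_of_nonneg_left hEf (by positivity)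
  have g11 : (1 - decayConst K r * lam) * E0 = E0 - lam / (16 * M) * E0 := by rw [hc]; ring
  rw [g11]
  linarith

/-- A Lyapunov function when the mean of the rotation is small. -/
lemma exists_lyapunov_of_lt_half (he : ‖e‖ = 1) (hφ : inner ℂ e (U e) = (φ : ℂ))
    (hρ : φ ^ 2 + ρ ^ 2 = 1) (hK : 0 ≤ K)
    {q r : ℝ} (hq : 0 < q) (hhalf : φ ^ 2 < 1 / 2) :
    ∃ E : H → ℝ, (∀ f, ‖f‖ ^ 2 ≤ 2 * E f ∧ E f ≤ 2 * ‖f‖ ^ 2) ∧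
      ∀ s, q ≤ s → s ≤ r * q → s ≤ 1 → ∀ f, E (U (partialUpdate e s f)) ≤
        (1 - decayConst K r * (q * ρ ^ 2 / (q ^ 2 + ρ ^ 2))) * E f := by
  -- For q > 1 no rate s with q ≤ s ≤ 1 exists.
  by_cases hq1 : 1 < q
  · exact ⟨fun f => ‖f‖ ^ 2, fun f => by constructor <;> nlinarith [sq_nonneg ‖f‖],
      fun s h1 _ h3 => absurd (h1.trans h3) (not_le.2 hq1)⟩
  push Not at hq1
  have hden : 0 < q ^ 2 + ρ ^ 2 := by positivity
  set lam : ℝ := q * ρ ^ 2 / (q ^ 2 + ρ ^ 2) with hlam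
  have hlam0 : 0 ≤ lam := by positivity
  have hlamq : lam ≤ q := by
    rw [hlam, div_le_iff₀ hden]; nlinarith [pow_pos hq 3]
  have hc0 : 0 < decayConst K r := decayConst_pos hK
  have hc : decayConst K r ≤ 1 / 16 := by
    unfold decayConst
    refine one_div_le_one_div_of_le (by norm_num) ?_
    nlinarith [sq_nonneg r, sq_nonneg K]
  have hle : ∀ f : H, ‖f - inner ℂ e f • e‖ ^ 2 ≤ ‖f‖ ^ 2 := fun f => by
    rw [norm_sq_eq_proj_add he f]; nlinarith [sq_nonneg ‖inner ℂ e f‖]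
  -- Here ρ² > 1/2, so one rotation turns a fixed share of the mean into fluctuation. Subtracting
  -- the fluctuation rewards this at once, and no cross term is needed.
  refine ⟨fun f => ‖f‖ ^ 2 - q / 4 * ‖f - inner ℂ e f • e‖ ^ 2, fun f => ?_, ?_⟩
  · have h1 := hle f
    have h2 : q / 4 * ‖f - inner ℂ e f • e‖ ^ 2 ≤ 1 / 4 * ‖f - inner ℂ e f • e‖ ^ 2 :=
      mul_le_mul_of_nonneg_right (by linarith) (sq_nonneg _)
    have h3 : 0 ≤ q / 4 * ‖f - inner ℂ e f • e‖ ^ 2 := by positivity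
    constructor <;> nlinarith [sq_nonneg ‖f‖]
  intro s hqs _ hs1 f
  have hs0 : 0 ≤ s := hq.le.trans hqs
  have hnorm' := norm_sq_partialUpdate he s f
  rw [← U.norm_map] at hnorm'
  have hnorm := norm_sq_eq_proj_add he f
  beta_reduce
  set a := inner ℂ e f with ha
  set g := f - a • e with hg
  set f' := U (partialUpdate e s f) with hf'
  -- The new fluctuation is a(U e - φ e), of norm ρ|a|, plus a remainder no larger than the old
  -- fluctuation.
  have hrho : ρ ^ 2 * ‖a‖ ^ 2 ≤
      2 * ‖f' - inner ℂ e f' • e‖ ^ 2 + 2 * ‖g‖ ^ 2 := by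
    set v := U (((1 - s : ℝ) : ℂ) • g) with hv
    have hv1 : ‖v‖ ≤ ‖g‖ := by
      rw [hv, U.norm_map, norm_smul, Complex.norm_real, Real.norm_eq_abs, abs_of_nonneg (by linarith)]
      exact mul_le_of_le_one_left (norm_nonneg _) (by linarith)
    have hsplit : f' - inner ℂ e f' • e =
        a • (U e - (φ : ℂ) • e) + (v - inner ℂ e v • e) := by
      have : f' = a • U e + v := by
        rw [hf', hv, partialUpdate, ← ha, ← hg, map_add, map_smul]
      rw [this, inner_add_right, inner_smul_right, hφ]
      module
    have hn : ‖a • (U e - (φ : ℂ) • e)‖ ^ 2 = ρ ^ 2 * ‖a‖ ^ 2 := by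
      rw [norm_smul, mul_pow, norm_sq_image_sub he hφ hρ]; ring
    have hw : ‖v - inner ℂ e v • e‖ ^ 2 ≤ ‖g‖ ^ 2 :=
      (hle v).trans (pow_le_pow_left₀ (norm_nonneg _) hv1 2)
    have htri : ‖a • (U e - (φ : ℂ) • e)‖ ≤
        ‖f' - inner ℂ e f' • e‖ + ‖v - inner ℂ e v • e‖ := by
      rw [hsplit]
      simpa using norm_sub_le (a • (U e - (φ : ℂ) • e) + (v - inner ℂ e v • e))
        (v - inner ℂ e v • e)
    rw [← hn]
    have := pow_le_pow_left₀ (norm_nonneg _) htri 2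
    nlinarith [sq_nonneg (‖f' - inner ℂ e f' • e‖ - ‖v - inner ℂ e v • e‖)]
  generalize ‖f' - inner ℂ e f' • e‖ = G' at *
  generalize ‖a‖ = A at *
  generalize ‖g‖ = G at *
  rw [hnorm', hnorm]
  have g7 : (1 - s) ^ 2 * G ^ 2 ≤ G ^ 2 - q * G ^ 2 :=
    one_sub_sq_mul_sq_le hs0 hqs hs1 G
  have g1 : 1 / 2 * A ^ 2 ≤ ρ ^ 2 * A ^ 2 :=
    mul_le_mul_of_nonneg_right (by linarith) (sq_nonneg _)
  have g2 : q / 4 * (A ^ 2 / 4 - G ^ 2) ≤ q / 4 * G' ^ 2 :=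
    mul_le_mul_of_nonneg_left (by linarith) (by linarith)
  have g3 : decayConst K r * lam * (A ^ 2 + G ^ 2 - q / 4 * G ^ 2) ≤
      q / 16 * (A ^ 2 + G ^ 2) := by
    refine mul_le_mul ?_ ?_ ?_ (by positivity)
    · calc _ ≤ 1 / 16 * q := mul_le_mul hc hlamq hlam0 (by norm_num)
        _ = q / 16 := by ring
    · have : 0 ≤ q / 4 * G ^ 2 := by positivity
      linarith
    · nlinarith [sq_nonneg A, mul_le_mul_of_nonneg_right hq1 (sq_nonneg G), sq_nonneg G]
  have g4 : 0 ≤ q * G ^ 2 := by positivity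
  nlinarith

lemma exists_lyapunov (he : ‖e‖ = 1) (hφ : inner ℂ e (U e) = (φ : ℂ)) (hρ0 : 0 ≤ ρ)
    (hρ : φ ^ 2 + ρ ^ 2 = 1) (hK : 0 ≤ K) (hU : ∀ x, ‖U x - (φ : ℂ) • x‖ ≤ K * ρ * ‖x‖)
    {q : ℝ} (r : ℝ) (hq : 0 < q) :
    ∃ E : H → ℝ, (∀ f, ‖f‖ ^ 2 ≤ 2 * E f ∧ E f ≤ 2 * ‖f‖ ^ 2) ∧
      ∀ s, q ≤ s → s ≤ r * q → s ≤ 1 → ∀ f, E (U (partialUpdate e s f)) ≤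
        (1 - decayConst K r * (q * ρ ^ 2 / (q ^ 2 + ρ ^ 2))) * E f := by
  rcases le_or_gt (1 / 2) (φ ^ 2) with h | h
  · exact exists_lyapunov_of_half_le he hφ hρ0 hρ hK hU hq h
  · exact exists_lyapunov_of_lt_half he hφ hρ hK hq h

/-- Exponential decay of the norm along an evolution whose update rates lie in `[q, r q]`. -/
lemma norm_sq_evolution_le (he : ‖e‖ = 1) (hφ : inner ℂ e (U e) = (φ : ℂ)) (hρ0 : 0 ≤ ρ)
    (hρ : φ ^ 2 + ρ ^ 2 = 1) (hK : 0 ≤ K) (hU : ∀ x, ‖U x - (φ : ℂ) • x‖ ≤ K * ρ * ‖x‖)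
    {q r : ℝ} (hq : 0 < q) (F : ℕ → H) (s : ℕ → ℝ) (l m : ℕ)
    (hF : ∀ k, F (k + 1) = U (partialUpdate e (s k) (F k)))
    (hs : ∀ k, l ≤ k → k < l + m → q ≤ s k ∧ s k ≤ r * q ∧ s k ≤ 1) :
    ‖F (l + m)‖ ^ 2 ≤
      4 * Real.exp (-(decayConst K r * (q * ρ ^ 2 / (q ^ 2 + ρ ^ 2)) * m)) * ‖F l‖ ^ 2 := by
  obtain ⟨E, hE, hstep⟩ := exists_lyapunov he hφ hρ0 hρ hK hU r hq
  set x := decayConst K r * (q * ρ ^ 2 / (q ^ 2 + ρ ^ 2)) with hx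
  have hE0 : ∀ f, 0 ≤ E f := fun f => by nlinarith [(hE f).1, sq_nonneg ‖f‖]
  have key : ∀ j, j ≤ m → E (F (l + j)) ≤ Real.exp (-(x * j)) * E (F l) := by
    intro j
    induction j with
    | zero => intro _; simp
    | succ j ih =>
      intro hj
      obtain ⟨h1, h2, h3⟩ := hs (l + j) (by omega) (by omega)
      calc E (F (l + (j + 1))) = E (U (partialUpdate e (s (l + j)) (F (l + j)))) := by
            rw [← hF]; rfl
        _ ≤ (1 - x) * E (F (l + j)) := hstep _ h1 h2 h3 _
        _ ≤ Real.exp (-x) * E (F (l + j)) :=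
            mul_le_mul_of_nonneg_right (by linarith [Real.add_one_le_exp (-x)]) (hE0 _)
        _ ≤ Real.exp (-x) * (Real.exp (-(x * j)) * E (F l)) :=
            mul_le_mul_of_nonneg_left (ih (by omega)) (Real.exp_pos _).le
        _ = Real.exp (-(x * (j + 1 : ℕ))) * E (F l) := by
            rw [← mul_assoc, ← Real.exp_add]; congr 2; push_cast; ring
  have h1 := key m le_rfl
  have h2 := (hE (F (l + m))).1
  have h3 := mul_le_mul_of_nonneg_left (hE (F l)).2 (Real.exp_pos (-(x * m))).le
  linarith

/-- Covers the times before the window, where the rates are only known to lie in [0, 1]. -/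
lemma norm_evolution_le (he : ‖e‖ = 1) (F : ℕ → H) (s : ℕ → ℝ)
    (hF : ∀ k, F (k + 1) = U (partialUpdate e (s k) (F k)))
    (hs : ∀ k, 0 ≤ s k ∧ s k ≤ 1) (l : ℕ) : ‖F l‖ ≤ ‖F 0‖ := by
  induction l with
  | zero => rfl
  | succ l ih =>
    rw [hF, U.norm_map]
    exact (norm_partialUpdate_le he (hs l).1 (hs l).2 _).trans ih

end Lyapunov

/-! ### Unit steps, lattice characters and their mean. -/

section Steps

variable {d : ℕ}

/-- The unit steps of `ℤ^d`, indexed by a coordinate and a sign. -/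
def stepVec (v : Fin d × Bool) : Fin d → ℤ := Pi.single v.1 (if v.2 then 1 else -1)

lemma stepVec_mem_unitSteps (v : Fin d × Bool) : stepVec v ∈ unitSteps d := by
  obtain ⟨i, b⟩ := v
  cases b
  · exact ⟨i, Or.inr rfl⟩
  · exact ⟨i, Or.inl rfl⟩

lemma exists_stepVec_eq {x : Fin d → ℤ} (hx : x ∈ unitSteps d) : ∃ v, stepVec v = x := by
  obtain ⟨i, rfl | rfl⟩ := hx
  · exact ⟨(i, true), rfl⟩
  · exact ⟨(i, false), rfl⟩

lemma stepVec_injective : Function.Injective (stepVec (d := d)) := by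
  rintro ⟨i, b⟩ ⟨j, c⟩ h
  have hi := congrFun h i
  by_cases hij : i = j
  · subst hij
    cases b <;> cases c <;> simp [stepVec] at hi ⊢
  · cases b <;> simp [stepVec, Pi.single_eq_of_ne hij] at hi

/-- The end point of a path with prescribed steps. -/
def pathSum {n : ℕ} (σ : Fin n → Fin d × Bool) : Fin d → ℤ := ∑ j, stepVec (σ j)

lemma pathSum_snoc {n : ℕ} (σ : Fin n → Fin d × Bool) (v : Fin d × Bool) :
    pathSum (Fin.snoc σ v : Fin (n + 1) → Fin d × Bool) = pathSum σ + stepVec v := by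
  simp [pathSum, Fin.sum_univ_castSucc]

/-- The character `x ↦ exp (i θ · x)` of `ℤ^d`. -/
noncomputable def latticeChar (θ : Fin d → ℝ) (x : Fin d → ℤ) : ℂ :=
  Complex.exp (((∑ i, θ i * x i : ℝ) : ℂ) * Complex.I)

lemma latticeChar_add (θ : Fin d → ℝ) (x y : Fin d → ℤ) :
    latticeChar θ (x + y) = latticeChar θ x * latticeChar θ y := by
  rw [latticeChar, latticeChar, latticeChar, ← Complex.exp_add, ← add_mul, ← Complex.ofReal_add,
    ← Finset.sum_add_distrib]
  simp [mul_add]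

lemma norm_latticeChar (θ : Fin d → ℝ) (x : Fin d → ℤ) : ‖latticeChar θ x‖ = 1 :=
  Complex.norm_exp_ofReal_mul_I _

lemma latticeChar_stepVec (θ : Fin d → ℝ) (i : Fin d) (b : Bool) :
    latticeChar θ (stepVec (i, b)) =
      Complex.exp (((if b then θ i else -θ i : ℝ) : ℂ) * Complex.I) := by
  rw [latticeChar]
  congr 3
  rw [Finset.sum_eq_single i]
  · cases b <;> simp [stepVec]
  · intro j _ hj
    simp [stepVec, Pi.single_eq_of_ne hj]
  · simp

/-- The mean of the character over the unit steps. -/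
noncomputable def meanCos (θ : Fin d → ℝ) : ℝ := (∑ i, Real.cos (θ i)) / d

lemma sum_latticeChar_stepVec (hd : 0 < d) (θ : Fin d → ℝ) :
    ∑ v, latticeChar θ (stepVec v) = ((2 * d * meanCos θ : ℝ) : ℂ) := by
  have hd' : (d : ℝ) ≠ 0 := by positivity
  have h : 2 * (d : ℝ) * meanCos θ = ∑ i, (2 * Real.cos (θ i)) := by
    rw [meanCos, ← Finset.mul_sum]; field_simp
  rw [h, Fintype.sum_prod_type, Complex.ofReal_sum]
  refine Finset.sum_congr rfl fun i _ => ?_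
  rw [Fintype.sum_bool, latticeChar_stepVec, latticeChar_stepVec]
  simp only [if_true, Bool.false_eq_true, if_false]
  push_cast
  rw [Complex.two_cos]

/-- A variance computation for numbers of modulus 1. It yields φ² ≤ 1 and, bounding one summand by
the sum, the constant K = √(2d) in `norm_twist_sub_le`. -/
lemma sum_norm_sq_latticeChar_sub (hd : 0 < d) (θ : Fin d → ℝ) :
    ∑ v, ‖latticeChar θ (stepVec v) - (meanCos θ : ℂ)‖ ^ 2 =
      2 * d * (1 - meanCos θ ^ 2) := by
  have h1 : ∀ v : Fin d × Bool, ‖latticeChar θ (stepVec v) - (meanCos θ : ℂ)‖ ^ 2 =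
      1 + meanCos θ ^ 2 - 2 * meanCos θ * (latticeChar θ (stepVec v)).re := by
    intro v
    have h := norm_latticeChar θ (stepVec v)
    have h2 : ‖latticeChar θ (stepVec v)‖ ^ 2 = 1 := by rw [h]; norm_num
    rw [Complex.sq_norm, Complex.normSq_apply] at h2 ⊢
    simp only [Complex.sub_re, Complex.sub_im, Complex.ofReal_re, Complex.ofReal_im]
    linarith
  have h2 : ∑ v : Fin d × Bool, (latticeChar θ (stepVec v)).re = 2 * d * meanCos θ := by
    rw [← Complex.re_sum, sum_latticeChar_stepVec hd, Complex.ofReal_re]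
  rw [Finset.sum_congr rfl fun v _ => h1 v, Finset.sum_sub_distrib, ← Finset.mul_sum, h2]
  simp
  ring

lemma meanCos_sq_le_one (hd : 0 < d) (θ : Fin d → ℝ) : meanCos θ ^ 2 ≤ 1 := by
  have h := sum_norm_sq_latticeChar_sub hd θ
  have h0 : 0 ≤ 2 * (d : ℝ) * (1 - meanCos θ ^ 2) := by
    rw [← h]; exact Finset.sum_nonneg fun _ _ => sq_nonneg _
  have : 0 < (2 * d : ℝ) := by positivity
  nlinarith

end Steps

/-! ### The Hilbert space of functions on the unit steps. -/

section Twist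

variable {d : ℕ}

/-- The normalized constant vector. -/
noncomputable def constVec (d : ℕ) : EuclideanSpace ℂ (Fin d × Bool) :=
  WithLp.toLp 2 fun _ => (((√(2 * d))⁻¹ : ℝ) : ℂ)

/-- Multiplication by the character on functions of the unit steps. -/
noncomputable def twist (θ : Fin d → ℝ) :
    EuclideanSpace ℂ (Fin d × Bool) →ₗᵢ[ℂ] EuclideanSpace ℂ (Fin d × Bool) where
  toFun f := WithLp.toLp 2 fun v => latticeChar θ (stepVec v) * f v
  map_add' f g := by ext v; simp [mul_add]
  map_smul' c f := by ext v; simp [mul_left_comm]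
  norm_map' f := by
    simp [EuclideanSpace.norm_eq, norm_latticeChar]

@[simp]
lemma twist_apply (θ : Fin d → ℝ) (f : EuclideanSpace ℂ (Fin d × Bool)) (v : Fin d × Bool) :
    twist θ f v = latticeChar θ (stepVec v) * f v := rfl

@[simp]
lemma constVec_apply (v : Fin d × Bool) : constVec d v = (((√(2 * d))⁻¹ : ℝ) : ℂ) := rfl

lemma inner_constVec (f : EuclideanSpace ℂ (Fin d × Bool)) :
    inner ℂ (constVec d) f = (((√(2 * d))⁻¹ : ℝ) : ℂ) * ∑ v, f v := by
  rw [PiLp.inner_apply, Finset.mul_sum]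
  refine Finset.sum_congr rfl fun v _ => ?_
  rw [RCLike.inner_apply, constVec_apply, Complex.conj_ofReal, mul_comm]

lemma inv_sqrt_mul_self (hd : 0 < d) : (√(2 * d : ℝ))⁻¹ * (√(2 * d : ℝ))⁻¹ = (2 * d : ℝ)⁻¹ := by
  rw [← mul_inv, Real.mul_self_sqrt (by positivity)]

lemma norm_constVec (hd : 0 < d) : ‖constVec d‖ = 1 := by
  have h : inner ℂ (constVec d) (constVec d) = (1 : ℂ) := by
    rw [inner_constVec]
    simp only [constVec_apply, Finset.sum_const, Finset.card_univ, Fintype.card_prod,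
      Fintype.card_fin, Fintype.card_bool, nsmul_eq_mul]
    rw [mul_left_comm, ← Complex.ofReal_mul, inv_sqrt_mul_self hd]
    push_cast
    have hd'' : (d : ℂ) ≠ 0 := by exact_mod_cast hd.ne'
    field_simp
  rw [inner_self_eq_norm_sq_to_K] at h
  have h2 : ‖constVec d‖ ^ 2 = 1 := Complex.ofReal_injective (by simpa using h)
  exact (pow_eq_one_iff_of_nonneg (norm_nonneg _) two_ne_zero).1 h2

lemma inner_constVec_twist (hd : 0 < d) (θ : Fin d → ℝ) :
    inner ℂ (constVec d) (twist θ (constVec d)) = (meanCos θ : ℂ) := by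
  have hd' : (2 * d : ℝ) ≠ 0 := by positivity
  simp only [inner_constVec, twist_apply, constVec_apply]
  rw [← Finset.sum_mul, sum_latticeChar_stepVec hd, mul_left_comm, ← Complex.ofReal_mul,
    ← Complex.ofReal_mul, inv_sqrt_mul_self hd]
  congr 1
  field_simp

lemma norm_twist_sub_le (hd : 0 < d) (θ : Fin d → ℝ) (f : EuclideanSpace ℂ (Fin d × Bool)) :
    ‖twist θ f - (meanCos θ : ℂ) • f‖ ≤ √(2 * d) * √(1 - meanCos θ ^ 2) * ‖f‖ := by
  have h1 : 0 ≤ 1 - meanCos θ ^ 2 := sub_nonneg.2 (meanCos_sq_le_one hd θ)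
  refine (sq_le_sq₀ (norm_nonneg _) (by positivity)).1 ?_
  rw [mul_pow, mul_pow, Real.sq_sqrt h1, Real.sq_sqrt (by positivity),
    ← sum_norm_sq_latticeChar_sub hd θ, EuclideanSpace.norm_sq_eq, EuclideanSpace.norm_sq_eq,
    Finset.mul_sum]
  refine Finset.sum_le_sum fun v _ => ?_
  have h2 : (twist θ f - (meanCos θ : ℂ) • f) v =
      (latticeChar θ (stepVec v) - (meanCos θ : ℂ)) * f v := by
    simp [sub_mul]
  rw [h2, norm_mul, mul_pow]
  exact mul_le_mul_of_nonneg_right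
    (Finset.single_le_sum (f := fun v => ‖latticeChar θ (stepVec v) - (meanCos θ : ℂ)‖ ^ 2)
      (fun _ _ => sq_nonneg _) (Finset.mem_univ v)) (sq_nonneg _)

/-- The all-ones matrix divided by 2d is the orthogonal projection onto the constants, so the
transition matrix is exactly `partialUpdate`. -/
lemma twist_partialUpdate_apply (hd : 0 < d) (θ : Fin d → ℝ) (s : ℝ)
    (f : EuclideanSpace ℂ (Fin d × Bool)) (v : Fin d × Bool) :
    twist θ (partialUpdate (constVec d) s f) v =
      (∑ u, f u * (stepTransition d s (stepVec u) (stepVec v) : ℂ)) *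
        latticeChar θ (stepVec v) := by
  classical
  have h1 : inner ℂ (constVec d) f * (((√(2 * d))⁻¹ : ℝ) : ℂ) =
      (((2 * d : ℝ)⁻¹ : ℝ) : ℂ) * ∑ u, f u := by
    rw [inner_constVec, mul_right_comm, ← Complex.ofReal_mul, inv_sqrt_mul_self hd]
  have h2 : ∑ u, f u * (stepTransition d s (stepVec u) (stepVec v) : ℂ) =
      (1 - s) * f v + s * ((((2 * d : ℝ)⁻¹ : ℝ) : ℂ) * ∑ u, f u) := by
    have : ∀ u, f u * (stepTransition d s (stepVec u) (stepVec v) : ℂ) =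
        (if u = v then (1 - s) * f u else 0) + s * (((2 * d : ℝ)⁻¹ : ℝ) : ℂ) * f u := by
      intro u
      rw [stepTransition]
      by_cases huv : u = v
      · subst huv; push_cast; simp; ring
      · rw [if_neg huv, if_neg (stepVec_injective.ne huv)]; push_cast; ring
    rw [Finset.sum_congr rfl fun u _ => this u, Finset.sum_add_distrib, ← Finset.mul_sum]
    simp [mul_assoc]
  rw [twist_apply, h2, mul_comm]
  congr 1
  simp only [partialUpdate, PiLp.add_apply, PiLp.smul_apply, PiLp.sub_apply, constVec_apply,
    smul_eq_mul, h1]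
  push_cast
  ring

end Twist

/-! ### From the Markov chain to the evolution of its Fourier transform. -/

section Paths

variable {d : ℕ} {p : ℕ → ℝ} {Ω : Type*} {Y : ℕ → Ω → (Fin d → ℤ)}

/-- The event that the first `n` steps are the prescribed ones. -/
def pathEvent (Y : ℕ → Ω → (Fin d → ℤ)) {n : ℕ} (σ : Fin n → Fin d × Bool) : Set Ω :=
  {ω | ∀ j : Fin n, Y (j + 1) ω = stepVec (σ j)}

lemma pathEvent_eq {n : ℕ} (σ : Fin n → Fin d × Bool) (y : ℕ → (Fin d → ℤ))
    (hy : ∀ j : Fin n, y (j + 1) = stepVec (σ j)) :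
    pathEvent Y σ = {ω | ∀ k ∈ Finset.Icc 1 n, Y k ω = y k} := by
  ext ω
  simp only [pathEvent, Set.mem_ofPred_eq, Finset.mem_Icc]
  constructor
  · rintro h k ⟨hk1, hkn⟩
    obtain ⟨j, rfl⟩ := Nat.exists_eq_add_of_le' hk1
    rw [h ⟨j, by omega⟩, ← hy]
  · intro h j
    rw [h (j + 1) ⟨by omega, by omega⟩, hy]

variable [MeasurableSpace Ω] {P : Measure Ω}

lemma measureReal_pathEvent_snoc (hY : IsConservativeStepChain d p P Y) {n : ℕ}
    (σ : Fin (n + 1) → Fin d × Bool) (v : Fin d × Bool) :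
    P.real (pathEvent Y (Fin.snoc σ v : Fin (n + 2) → Fin d × Bool)) =
      P.real (pathEvent Y σ) *
        stepTransition d (p (n + 1)) (stepVec (σ (Fin.last n))) (stepVec v) := by
  set τ : Fin (n + 2) → Fin d × Bool := Fin.snoc σ v with hτ
  -- Times start at 1 and path indices at 0, hence the shift; the default 0 is never read at times
  -- 1, …, n + 2.
  set y : ℕ → (Fin d → ℤ) := fun k => if h : k - 1 < n + 2 then stepVec (τ ⟨k - 1, h⟩) else 0
    with hy
  have hy1 : ∀ j : Fin (n + 2), y (j + 1) = stepVec (τ j) := by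
    intro j
    simp [hy]
  have hy2 : ∀ j : Fin (n + 1), y (j + 1) = stepVec (σ j) := by
    intro j
    have := hy1 j.castSucc
    rwa [hτ, Fin.snoc_castSucc, Fin.val_castSucc] at this
  have h := hY.markov (n + 1) (by omega) y ?_
  · rw [pathEvent_eq τ y hy1, pathEvent_eq σ y hy2, h]
    have e1 := hy2 (Fin.last n)
    have e2 := hy1 (Fin.last (n + 1))
    rw [hτ, Fin.snoc_last] at e2
    rw [Fin.val_last] at e1 e2
    rw [e1, e2]
  · intro k hk
    rw [Finset.mem_Icc] at hk
    obtain ⟨j, rfl⟩ := Nat.exists_eq_add_of_le' hk.1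
    have := hy1 ⟨j, by omega⟩
    rw [show j + 1 = ((⟨j, by omega⟩ : Fin (n + 2)) : ℕ) + 1 from rfl, this]
    exact stepVec_mem_unitSteps _

/-- The Fourier transform of the law of the walk at time `n + 1`, restricted to the event that the
last step is `v`. -/
noncomputable def charVec (P : Measure Ω) (Y : ℕ → Ω → (Fin d → ℤ)) (θ : Fin d → ℝ) (n : ℕ) :
    EuclideanSpace ℂ (Fin d × Bool) :=
  WithLp.toLp 2 fun v => ∑ σ : Fin n → Fin d × Bool,
    (P.real (pathEvent Y (Fin.snoc σ v : Fin (n + 1) → Fin d × Bool)) : ℂ) *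
      latticeChar θ (pathSum (Fin.snoc σ v : Fin (n + 1) → Fin d × Bool))

/-- The Fourier transform of the law of the walk at time `n`, as a sum over paths. -/
noncomputable def charSum (P : Measure Ω) (Y : ℕ → Ω → (Fin d → ℤ)) (θ : Fin d → ℝ) (n : ℕ) : ℂ :=
  ∑ σ : Fin n → Fin d × Bool, (P.real (pathEvent Y σ) : ℂ) * latticeChar θ (pathSum σ)

lemma sum_paths_succ {M : Type*} [AddCommMonoid M] {n : ℕ}
    (F : (Fin (n + 1) → Fin d × Bool) → M) :
    ∑ σ, F σ = ∑ v, ∑ σ : Fin n → Fin d × Bool, F (Fin.snoc σ v) := by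
  rw [← (Fin.snocEquiv fun _ : Fin (n + 1) => Fin d × Bool).sum_comp F, Fintype.sum_prod_type]
  rfl

lemma charVec_succ (hd : 0 < d) (hY : IsConservativeStepChain d p P Y) (θ : Fin d → ℝ) (n : ℕ) :
    charVec P Y θ (n + 1) = twist θ (partialUpdate (constVec d) (p (n + 1)) (charVec P Y θ n)) := by
  ext v
  rw [twist_partialUpdate_apply hd]
  simp only [charVec]
  rw [Finset.sum_mul, sum_paths_succ]
  refine Finset.sum_congr rfl fun u _ => ?_
  rw [Finset.sum_mul, Finset.sum_mul]
  refine Finset.sum_congr rfl fun σ _ => ?_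
  rw [measureReal_pathEvent_snoc hY, pathSum_snoc _ v, latticeChar_add, Fin.snoc_last]
  push_cast
  ring

lemma sum_charVec (θ : Fin d → ℝ) (n : ℕ) : ∑ v, charVec P Y θ n v = charSum P Y θ (n + 1) := by
  rw [charSum, sum_paths_succ]
  rfl

lemma norm_charSum_succ_le (hd : 0 < d) (θ : Fin d → ℝ) (n : ℕ) :
    ‖charSum P Y θ (n + 1)‖ ≤ √(2 * d) * ‖charVec P Y θ n‖ := by
  have h := norm_inner_le_norm (𝕜 := ℂ) (constVec d) (charVec P Y θ n)
  rw [norm_constVec hd, one_mul, inner_constVec, sum_charVec, norm_mul, Complex.norm_real,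
    Real.norm_of_nonneg (by positivity)] at h
  have h0 : 0 < √(2 * d : ℝ) := by positivity
  rwa [inv_mul_le_iff₀ h0] at h

lemma norm_charVec_zero_le (hd : 0 < d) (hY : IsConservativeStepChain d p P Y) (θ : Fin d → ℝ) :
    ‖charVec P Y θ 0‖ ≤ 1 := by
  have h : ∀ v, ‖charVec P Y θ 0 v‖ = 1 / (2 * d) := by
    intro v
    have hset : pathEvent Y (Fin.snoc (default : Fin 0 → Fin d × Bool) v : Fin 1 → Fin d × Bool) =
        {ω | Y 1 ω = stepVec v} := by
      ext ω
      simp [pathEvent, Fin.snoc]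
    simp only [charVec, Fintype.sum_unique]
    rw [hset, hY.initial _ (stepVec_mem_unitSteps v), norm_mul, norm_latticeChar, mul_one,
      Complex.norm_real, Real.norm_of_nonneg (by positivity)]
  refine (sq_le_sq₀ (norm_nonneg _) zero_le_one).1 ?_
  rw [EuclideanSpace.norm_sq_eq, Finset.sum_congr rfl fun v _ => by rw [h v]]
  have hd1 : (1 : ℝ) ≤ d := by exact_mod_cast hd
  simp only [Finset.sum_const, Finset.card_univ, Fintype.card_prod, Fintype.card_fin,
    Fintype.card_bool, nsmul_eq_mul]
  push_cast
  rw [div_pow, one_pow, mul_one_div, div_le_iff₀ (by positivity)]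
  nlinarith

/-- Decay of the Fourier transform of the walk, in terms of the update rates in a window. -/
lemma norm_charSum_le (hd : 0 < d) (hp : ∀ n, 1 ≤ n → 0 ≤ p n ∧ p n ≤ 1)
    (hY : IsConservativeStepChain d p P Y) {q r : ℝ} (hq : 0 < q) {l m : ℕ}
    (hqp : ∀ k, l < k → k ≤ l + m → q ≤ p k ∧ p k ≤ r * q) (θ : Fin d → ℝ) :
    ‖charSum P Y θ (l + m + 1)‖ ≤ 2 * √(2 * d) * Real.exp (-(decayConst √(2 * d) r / 2 *
      (q * (1 - meanCos θ ^ 2) / (q ^ 2 + (1 - meanCos θ ^ 2))) * m)) := by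
  have h1 : 0 ≤ 1 - meanCos θ ^ 2 := sub_nonneg.2 (meanCos_sq_le_one hd θ)
  have hρ : meanCos θ ^ 2 + √(1 - meanCos θ ^ 2) ^ 2 = 1 := by rw [Real.sq_sqrt h1]; ring
  have hs : ∀ k, 0 ≤ p (k + 1) ∧ p (k + 1) ≤ 1 := fun k => hp (k + 1) (by omega)
  have hdecay := norm_sq_evolution_le (norm_constVec hd) (inner_constVec_twist hd θ)
    (Real.sqrt_nonneg _) hρ (Real.sqrt_nonneg _) (norm_twist_sub_le hd θ) (r := r) hq
    (charVec P Y θ) (fun k => p (k + 1)) l m (charVec_succ hd hY θ)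
    (fun k hk1 hk2 => ⟨(hqp _ (by omega) (by omega)).1, (hqp _ (by omega) (by omega)).2, (hs k).2⟩)
  have hl : ‖charVec P Y θ l‖ ≤ 1 :=
    (norm_evolution_le (norm_constVec hd) (charVec P Y θ) (fun k => p (k + 1))
      (charVec_succ hd hY θ) hs l).trans (norm_charVec_zero_le hd hY θ)
  rw [Real.sq_sqrt h1] at hdecay
  -- The decay estimate is for the squared norm, so the exponent is halved.
  set x := decayConst √(2 * d) r / 2 *
      (q * (1 - meanCos θ ^ 2) / (q ^ 2 + (1 - meanCos θ ^ 2))) * m with hx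
  have hx2 : decayConst √(2 * d) r *
      (q * (1 - meanCos θ ^ 2) / (q ^ 2 + (1 - meanCos θ ^ 2))) * m = x + x := by rw [hx]; ring
  have hnorm : ‖charVec P Y θ (l + m)‖ ≤ 2 * Real.exp (-x) := by
    refine (sq_le_sq₀ (norm_nonneg _) (by positivity)).1 (hdecay.trans ?_)
    rw [hx2, neg_add, Real.exp_add]
    have : ‖charVec P Y θ l‖ ^ 2 ≤ 1 := pow_le_one₀ (norm_nonneg _) hl
    have h4 : 0 ≤ 4 * (Real.exp (-x) * Real.exp (-x)) := by positivity
    nlinarith [mul_le_mul_of_nonneg_left this h4]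
  refine (norm_charSum_succ_le hd θ (l + m)).trans ?_
  calc _ ≤ √(2 * d) * (2 * Real.exp (-x)) :=
        mul_le_mul_of_nonneg_left hnorm (Real.sqrt_nonneg _)
    _ = _ := by ring

end Paths

/-! ### Integrals over the torus. -/

section Torus

/-- Lebesgue measure on the cube `(-π, π]^d`. -/
noncomputable def torusMeasure (d : ℕ) : Measure (Fin d → ℝ) :=
  Measure.pi fun _ => volume.restrict (Set.Ioc (-Real.pi) Real.pi)

instance (d : ℕ) : IsFiniteMeasure (torusMeasure d) := by
  unfold torusMeasure; infer_instance

variable {d : ℕ}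

lemma torusMeasure_real_univ : (torusMeasure d).real Set.univ = (2 * Real.pi) ^ d := by
  have h0 : (0 : ℝ) ≤ Real.pi - -Real.pi := by linarith [Real.pi_pos]
  rw [torusMeasure, measureReal_def, Measure.pi_univ]
  simp only [Measure.restrict_apply_univ, Real.volume_Ioc, Finset.prod_const, Finset.card_univ,
    Fintype.card_fin, ENNReal.toReal_pow, ENNReal.toReal_ofReal h0]
  ring

lemma integral_circle_char (k : ℤ) :
    ∫ t in Set.Ioc (-Real.pi) Real.pi, Complex.exp ((t * k : ℝ) * Complex.I) =
      if k = 0 then (2 * Real.pi : ℂ) else 0 := by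
  rw [← intervalIntegral.integral_of_le (by linarith [Real.pi_pos])]
  split_ifs with hk
  · subst hk
    simp
    ring
  · have hc : (k * Complex.I : ℂ) ≠ 0 := mul_ne_zero (by exact_mod_cast hk) Complex.I_ne_zero
    have h := integral_exp_mul_complex (a := -Real.pi) (b := Real.pi) hc
    have h2 : Complex.exp (k * Complex.I * (Real.pi : ℝ)) =
        Complex.exp (k * Complex.I * (-Real.pi : ℝ)) := by
      rw [Complex.exp_eq_exp_iff_exists_int]
      exact ⟨k, by push_cast; ring⟩
    rw [h2, sub_self, zero_div] at h
    rw [← h]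
    refine intervalIntegral.integral_congr fun t _ => ?_
    congr 1
    push_cast
    ring

lemma latticeChar_eq_prod (θ : Fin d → ℝ) (x : Fin d → ℤ) :
    latticeChar θ x = ∏ i, Complex.exp ((θ i * x i : ℝ) * Complex.I) := by
  rw [latticeChar, ← Complex.exp_sum, ← Finset.sum_mul, Complex.ofReal_sum]

lemma integral_latticeChar (x : Fin d → ℤ) :
    ∫ θ, latticeChar θ x ∂torusMeasure d = if x = 0 then (2 * Real.pi : ℂ) ^ d else 0 := by
  simp only [latticeChar_eq_prod]
  rw [torusMeasure, integral_fintype_prod_eq_prod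
    (f := fun i t => Complex.exp ((t * x i : ℝ) * Complex.I))]
  simp only [integral_circle_char]
  split_ifs with h
  · subst h; simp
  · obtain ⟨i, hi⟩ := Function.ne_iff.1 h
    exact Finset.prod_eq_zero (Finset.mem_univ i) (if_neg hi)

lemma continuous_latticeChar (x : Fin d → ℤ) : Continuous fun θ : Fin d → ℝ => latticeChar θ x := by
  unfold latticeChar; fun_prop

lemma integrable_torusMeasure {E : Type*} [NormedAddCommGroup E] [SecondCountableTopology E]
    {f : (Fin d → ℝ) → E}
    (hf : Continuous f) (C : ℝ) (hC : ∀ θ, ‖f θ‖ ≤ C) : Integrable f (torusMeasure d) :=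
  Integrable.of_bound hf.aestronglyMeasurable C (Eventually.of_forall hC)

/-- Comparison with a Gaussian through 1 - cos t ≥ 2t²/π² on [-π, π]. -/
lemma setIntegral_exp_one_sub_cos_le {b : ℝ} (hb : 0 < b) :
    ∫ t in Set.Ioc (-Real.pi) Real.pi, Real.exp (-(b * (1 - Real.cos t))) ≤
      √(Real.pi ^ 3 / (2 * b)) := by
  have hb' : 0 < b * (2 / Real.pi ^ 2) := by positivity
  have h1 : ∫ t in Set.Ioc (-Real.pi) Real.pi, Real.exp (-(b * (1 - Real.cos t))) ≤
      ∫ t in Set.Ioc (-Real.pi) Real.pi, Real.exp (-(b * (2 / Real.pi ^ 2)) * t ^ 2) := by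
    refine integral_mono_of_nonneg (Eventually.of_forall fun _ => (Real.exp_pos _).le)
      (integrable_exp_neg_mul_sq hb').integrableOn ?_
    refine (ae_restrict_mem measurableSet_Ioc).mono fun t ht => Real.exp_le_exp.2 ?_
    have := Real.cos_le_one_sub_mul_cos_sq (abs_le.2 (Set.Ioc_subset_Icc_self ht))
    have := mul_le_mul_of_nonneg_left this hb.le
    linarith
  refine h1.trans ((setIntegral_le_integral (integrable_exp_neg_mul_sq hb')
    (Eventually.of_forall fun _ => (Real.exp_pos _).le)).trans (le_of_eq ?_))
  rw [integral_gaussian]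
  congr 1
  field_simp

/-- Translation by π and periodicity reduce this to the previous bound. -/
lemma setIntegral_exp_one_add_cos_le {b : ℝ} (hb : 0 < b) :
    ∫ t in Set.Ioc (-Real.pi) Real.pi, Real.exp (-(b * (1 + Real.cos t))) ≤
      √(Real.pi ^ 3 / (2 * b)) := by
  refine le_trans (le_of_eq ?_) (setIntegral_exp_one_sub_cos_le hb)
  have hle : -Real.pi ≤ Real.pi := by linarith [Real.pi_pos]
  rw [← intervalIntegral.integral_of_le hle, ← intervalIntegral.integral_of_le hle]
  have hper : Function.Periodic (fun t => Real.exp (-(b * (1 - Real.cos t)))) (2 * Real.pi) :=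
    fun t => by simp only [Real.cos_add_two_pi]
  have h := hper.intervalIntegral_add_eq (-Real.pi) 0
  have h2 := intervalIntegral.integral_comp_add_right (a := -Real.pi) (b := Real.pi)
    (fun t => Real.exp (-(b * (1 - Real.cos t)))) Real.pi
  simp only [Real.cos_add_pi, sub_neg_eq_add] at h2
  rw [h2, show -Real.pi + Real.pi = 0 by ring, show Real.pi + Real.pi = 0 + 2 * Real.pi by ring,
    ← h, show -Real.pi + 2 * Real.pi = Real.pi by ring]

lemma continuous_meanCos : Continuous (meanCos (d := d)) := by
  unfold meanCos; fun_prop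

/-- `meanCos` averages over coordinates, so the integrand factorizes; d one-dimensional Gaussian
bounds produce the exponent d/2. -/
lemma integral_exp_one_sub_meanCos_le (hd : 0 < d) {z : ℝ} (hz : 0 < z) :
    ∫ θ, Real.exp (-(z * (1 - meanCos θ))) ∂torusMeasure d ≤
      (Real.pi ^ 3 * d / (2 * z)) ^ ((d : ℝ) / 2) := by
  have hd' : (0 : ℝ) < d := by exact_mod_cast hd
  have h : ∀ θ : Fin d → ℝ, Real.exp (-(z * (1 - meanCos θ))) =
      ∏ i, Real.exp (-(z / d * (1 - Real.cos (θ i)))) := fun θ => by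
    rw [← Real.exp_sum, Finset.sum_neg_distrib, ← Finset.mul_sum, Finset.sum_sub_distrib, meanCos]
    congr 2
    simp
    field_simp
  simp only [h]
  rw [torusMeasure, integral_fintype_prod_eq_prod
    (f := fun _ t => Real.exp (-(z / d * (1 - Real.cos t))))]
  rw [Finset.prod_const, Finset.card_univ, Fintype.card_fin]
  refine (pow_le_pow_left₀ (integral_nonneg fun _ => (Real.exp_pos _).le)
    (setIntegral_exp_one_sub_cos_le (div_pos hz hd')) d).trans (le_of_eq ?_)
  rw [Real.sqrt_eq_rpow, ← Real.rpow_natCast, ← Real.rpow_mul (by positivity)]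
  congr 1
  · field_simp
  · ring

lemma integral_exp_one_add_meanCos_le (hd : 0 < d) {z : ℝ} (hz : 0 < z) :
    ∫ θ, Real.exp (-(z * (1 + meanCos θ))) ∂torusMeasure d ≤
      (Real.pi ^ 3 * d / (2 * z)) ^ ((d : ℝ) / 2) := by
  have hd' : (0 : ℝ) < d := by exact_mod_cast hd
  have h : ∀ θ : Fin d → ℝ, Real.exp (-(z * (1 + meanCos θ))) =
      ∏ i, Real.exp (-(z / d * (1 + Real.cos (θ i)))) := fun θ => by
    rw [← Real.exp_sum, Finset.sum_neg_distrib, ← Finset.mul_sum, Finset.sum_add_distrib, meanCos]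
    congr 2
    simp
    field_simp
  simp only [h]
  rw [torusMeasure, integral_fintype_prod_eq_prod
    (f := fun _ t => Real.exp (-(z / d * (1 + Real.cos t))))]
  rw [Finset.prod_const, Finset.card_univ, Fintype.card_fin]
  refine (pow_le_pow_left₀ (integral_nonneg fun _ => (Real.exp_pos _).le)
    (setIntegral_exp_one_add_cos_le (div_pos hz hd')) d).trans (le_of_eq ?_)
  rw [Real.sqrt_eq_rpow, ← Real.rpow_natCast, ← Real.rpow_mul (by positivity)]
  congr 1
  · field_simp
  · ring

/-- For u ≥ q² the rate is at least q/2, and for u ≤ q² it is at least u/(2q). -/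
lemma exp_rate_le {y q u : ℝ} (hy : 0 ≤ y) (hq : 0 < q) (hu : 0 ≤ u) :
    Real.exp (-(y * (q * u / (q ^ 2 + u)))) ≤
      Real.exp (-(y * q / 2)) + Real.exp (-(y / (2 * q) * u)) := by
  have hden : 0 < q ^ 2 + u := by positivity
  rcases le_total (q ^ 2) u with h | h
  · have : q / 2 ≤ q * u / (q ^ 2 + u) := by
      rw [le_div_iff₀ hden]; nlinarith
    have h2 := mul_le_mul_of_nonneg_left this hy
    have h3 : Real.exp (-(y * (q * u / (q ^ 2 + u)))) ≤ Real.exp (-(y * q / 2)) :=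
      Real.exp_le_exp.2 (by linarith)
    linarith [Real.exp_pos (-(y / (2 * q) * u))]
  · have : u / (2 * q) ≤ q * u / (q ^ 2 + u) := by
      rw [div_le_div_iff₀ (by positivity) hden]; nlinarith
    have h2 := mul_le_mul_of_nonneg_left this hy
    have h4 : y / (2 * q) * u = y * (u / (2 * q)) := by ring
    have h3 : Real.exp (-(y * (q * u / (q ^ 2 + u)))) ≤ Real.exp (-(y / (2 * q) * u)) :=
      Real.exp_le_exp.2 (by linarith)
    linarith [Real.exp_pos (-(y * q / 2))]

/-- Since 1 - φ² ≥ 1 - |φ|, the degeneracies φ = 1 (at θ = 0) and φ = -1 (at θ = (π, …, π)) can be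
integrated separately. -/
lemma exp_one_sub_sq_le {z φ : ℝ} (hz : 0 ≤ z) (hφ : φ ^ 2 ≤ 1) :
    Real.exp (-(z * (1 - φ ^ 2))) ≤
      Real.exp (-(z * (1 - φ))) + Real.exp (-(z * (1 + φ))) := by
  obtain ⟨h1, h2⟩ := abs_le.1 ((sq_le_one_iff_abs_le_one φ).1 hφ)
  rcases le_total 0 φ with h | h
  · have h3 : Real.exp (-(z * (1 - φ ^ 2))) ≤ Real.exp (-(z * (1 - φ))) :=
      Real.exp_le_exp.2 (by nlinarith [mul_nonneg hz (mul_nonneg h (sub_nonneg.2 h2))])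
    linarith [Real.exp_pos (-(z * (1 + φ)))]
  · have h3 : Real.exp (-(z * (1 - φ ^ 2))) ≤ Real.exp (-(z * (1 + φ))) :=
      Real.exp_le_exp.2 (by
        nlinarith [mul_nonneg hz (mul_nonneg (neg_nonneg.2 h) (by linarith : (0 : ℝ) ≤ 1 + φ))])
    linarith [Real.exp_pos (-(z * (1 - φ)))]

lemma integral_exp_rate_le (hd : 0 < d) {y q : ℝ} (hy : 0 < y) (hq : 0 < q) :
    ∫ θ, Real.exp (-(y * (q * (1 - meanCos θ ^ 2) / (q ^ 2 + (1 - meanCos θ ^ 2)))))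
        ∂torusMeasure d ≤
      (2 * Real.pi) ^ d * Real.exp (-(y * q / 2)) +
        2 * (Real.pi ^ 3 * d * (q / y)) ^ ((d : ℝ) / 2) := by
  set z := y / (2 * q) with hz
  have hz0 : 0 < z := by positivity
  have hφ : ∀ θ : Fin d → ℝ, meanCos θ ^ 2 ≤ 1 := meanCos_sq_le_one hd
  have hφ' := fun θ => abs_le.1 ((sq_le_one_iff_abs_le_one (meanCos (d := d) θ)).1 (hφ θ))
  have i1 : Integrable (fun θ : Fin d → ℝ => Real.exp (-(z * (1 - meanCos θ))))
      (torusMeasure d) := by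
    refine integrable_torusMeasure ?_ 1 fun θ => ?_
    · have := continuous_meanCos (d := d); fun_prop
    · rw [Real.norm_of_nonneg (Real.exp_pos _).le, Real.exp_le_one_iff]
      nlinarith [mul_nonneg hz0.le (sub_nonneg.2 (hφ' θ).2)]
  have i2 : Integrable (fun θ : Fin d → ℝ => Real.exp (-(z * (1 + meanCos θ))))
      (torusMeasure d) := by
    refine integrable_torusMeasure ?_ 1 fun θ => ?_
    · have := continuous_meanCos (d := d); fun_prop
    · rw [Real.norm_of_nonneg (Real.exp_pos _).le, Real.exp_le_one_iff]
      nlinarith [mul_nonneg hz0.le (by linarith [(hφ' θ).1] : 0 ≤ 1 + meanCos θ)]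
  have i0 : Integrable (fun _ : Fin d → ℝ => Real.exp (-(y * q / 2))) (torusMeasure d) :=
    integrable_const _
  calc _ ≤ ∫ θ, (Real.exp (-(y * q / 2)) + (Real.exp (-(z * (1 - meanCos θ))) +
        Real.exp (-(z * (1 + meanCos θ))))) ∂torusMeasure d := by
        refine integral_mono_of_nonneg (Eventually.of_forall fun _ => (Real.exp_pos _).le)
          (i0.add (i1.add i2)) (Eventually.of_forall fun θ => ?_)
        exact (exp_rate_le hy.le hq (sub_nonneg.2 (hφ θ))).trans
          (add_le_add le_rfl (exp_one_sub_sq_le hz0.le (hφ θ)))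
    _ = (2 * Real.pi) ^ d * Real.exp (-(y * q / 2)) +
        ((∫ θ, Real.exp (-(z * (1 - meanCos θ))) ∂torusMeasure d) +
          ∫ θ, Real.exp (-(z * (1 + meanCos θ))) ∂torusMeasure d) := by
        have i12 : Integrable (fun θ : Fin d → ℝ => Real.exp (-(z * (1 - meanCos θ))) +
          Real.exp (-(z * (1 + meanCos θ)))) (torusMeasure d) := i1.add i2
        rw [integral_add i0 i12, integral_add i1 i2, integral_const,
          torusMeasure_real_univ, smul_eq_mul]
    _ ≤ _ := by
        have h1 := integral_exp_one_sub_meanCos_le hd hz0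
        have h2 := integral_exp_one_add_meanCos_le hd hz0
        have h3 : Real.pi ^ 3 * d / (2 * z) = Real.pi ^ 3 * d * (q / y) := by
          rw [hz]; field_simp
        rw [h3] at h1 h2
        linarith

end Torus

/-! ### Fourier inversion and the local bound. -/

section Inversion

variable {d : ℕ} {p : ℕ → ℝ} {Ω : Type*} {Y : ℕ → Ω → (Fin d → ℤ)}

lemma conservativeWalk_eq_pathSum {n : ℕ} {σ : Fin n → Fin d × Bool} {ω : Ω}
    (h : ω ∈ pathEvent Y σ) : conservativeWalk Y n ω = pathSum σ := by
  rw [conservativeWalk, pathSum, ← Finset.sum_congr rfl fun j _ => h j,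
    Fin.sum_univ_eq_sum_range (fun j => Y (j + 1) ω) n, Finset.range_eq_Ico,
    Finset.sum_Ico_add' (fun j => Y j ω) 0 n 1]
  rfl

lemma pathEvent_disjoint {n : ℕ} {σ τ : Fin n → Fin d × Bool} (h : σ ≠ τ) :
    Disjoint (pathEvent Y σ) (pathEvent Y τ) := by
  rw [Set.disjoint_left]
  intro ω h1 h2
  exact h (funext fun j => stepVec_injective ((h1 j).symm.trans (h2 j)))

variable [MeasurableSpace Ω] {P : Measure Ω}

lemma measurableSet_pathEvent (hY : IsConservativeStepChain d p P Y) {n : ℕ}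
    (σ : Fin n → Fin d × Bool) : MeasurableSet (pathEvent Y σ) := by
  have : pathEvent Y σ = ⋂ j : Fin n, Y (j + 1) ⁻¹' {stepVec (σ j)} := by
    ext ω; simp [pathEvent]
  rw [this]
  exact MeasurableSet.iInter fun j => hY.measurable _ (by omega) (measurableSet_singleton _)

lemma ae_mem_pathEvent (hY : IsConservativeStepChain d p P Y) (n : ℕ) :
    ∀ᵐ ω ∂P, ∃ σ : Fin n → Fin d × Bool, ω ∈ pathEvent Y σ := by
  have h : ∀ᵐ ω ∂P, ∀ j : Fin n, Y (j + 1) ω ∈ unitSteps d :=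
    ae_all_iff.2 fun j => hY.mem_unitSteps _ (by omega)
  filter_upwards [h] with ω hω
  choose σ hσ using fun j => exists_stepVec_eq (hω j)
  exact ⟨σ, fun j => (hσ j).symm⟩

lemma measureReal_walk_eq [IsProbabilityMeasure P] (hY : IsConservativeStepChain d p P Y) (n : ℕ)
    (w : Fin d → ℤ) :
    P.real {ω | conservativeWalk Y n ω = w} =
      ∑ σ : Fin n → Fin d × Bool, if pathSum σ = w then P.real (pathEvent Y σ) else 0 := by
  classical
  rw [← Finset.sum_filter, ← measureReal_biUnion_finset
    (fun σ _ τ _ h => pathEvent_disjoint h) (fun σ _ => measurableSet_pathEvent hY σ)]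
  refine measureReal_congr ?_
  filter_upwards [ae_mem_pathEvent hY n] with ω hω
  obtain ⟨σ, hσ⟩ := hω
  refine propext ⟨fun h => ?_, fun h => ?_⟩
  · refine Set.mem_biUnion (x := σ) ?_ hσ
    have h' : conservativeWalk Y n ω = w := h
    rw [conservativeWalk_eq_pathSum hσ] at h'
    simpa using h'
  · obtain ⟨τ, hτ, hω⟩ := Set.mem_iUnion₂.1 h
    have hτ' : pathSum τ = w := by simpa using hτ
    exact (conservativeWalk_eq_pathSum hω).trans hτ'

lemma fourier_inversion [IsProbabilityMeasure P] (hY : IsConservativeStepChain d p P Y) (n : ℕ)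
    (w : Fin d → ℤ) :
    ∫ θ, charSum P Y θ n * latticeChar θ (-w) ∂torusMeasure d =
      (((2 * Real.pi) ^ d * P.real {ω | conservativeWalk Y n ω = w} : ℝ) : ℂ) := by
  have h : ∀ θ, charSum P Y θ n * latticeChar θ (-w) = ∑ σ : Fin n → Fin d × Bool,
      (P.real (pathEvent Y σ) : ℂ) * latticeChar θ (pathSum σ + -w) := fun θ => by
    simp only [charSum, Finset.sum_mul, latticeChar_add, mul_assoc]
  simp only [h]
  rw [integral_finsetSum _ fun σ _ => (integrable_torusMeasure (continuous_latticeChar _) 1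
    fun θ => (norm_latticeChar θ _).le).const_mul _, measureReal_walk_eq hY, Finset.mul_sum,
    Complex.ofReal_sum]
  refine Finset.sum_congr rfl fun σ _ => ?_
  rw [integral_const_mul, integral_latticeChar]
  by_cases hw : pathSum σ = w
  · rw [if_pos hw, if_pos (by rw [hw, add_neg_cancel])]
    push_cast
    ring
  · rw [if_neg hw, if_neg (fun h0 => hw (add_neg_eq_zero.1 h0))]
    simp

/-- Local bound for the walk in terms of the update rates in a window. -/
lemma exists_measureReal_walk_le (hd : 0 < d) (r : ℝ) :
    ∃ C c : ℝ, 0 < C ∧ 0 < c ∧ ∀ (p : ℕ → ℝ) (Ω : Type*) [MeasurableSpace Ω] (P : Measure Ω)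
      [IsProbabilityMeasure P] (Y : ℕ → Ω → (Fin d → ℤ)), (∀ n, 1 ≤ n → 0 ≤ p n ∧ p n ≤ 1) →
      IsConservativeStepChain d p P Y → ∀ (q : ℝ) (l m : ℕ), 0 < q → 0 < m →
      (∀ k, l < k → k ≤ l + m → q ≤ p k ∧ p k ≤ r * q) → ∀ w : Fin d → ℤ,
      P.real {ω | conservativeWalk Y (l + m + 1) ω = w} ≤
        C * (Real.exp (-(c * (m * q))) + (q / m) ^ ((d : ℝ) / 2)) := by
  have hd' : (0 : ℝ) < d := by exact_mod_cast hd
  set b := decayConst √(2 * d) r / 2 with hb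
  have hb0 : 0 < b := half_pos (decayConst_pos (Real.sqrt_nonneg _))
  set A := 2 * √(2 * d : ℝ) with hA
  have hA0 : 0 < A := by positivity
  set T := (2 * Real.pi) ^ d with hT
  have hT0 : 0 < T := by positivity
  set B := 2 * (Real.pi ^ 3 * d / b) ^ ((d : ℝ) / 2) with hB
  have hB0 : 0 < B := by positivity
  -- The two terms come with coefficients A and AB/T; their sum serves for both.
  refine ⟨A + A * B / T, b / 2, by positivity, by positivity, ?_⟩
  intro p Ω _ P _ Y hp hY q l m hq hm hqp w
  have hm0 : (0 : ℝ) < m := by exact_mod_cast hm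
  have h1 : T * P.real {ω | conservativeWalk Y (l + m + 1) ω = w} ≤
      ∫ θ, A * Real.exp (-(b * m * (q * (1 - meanCos θ ^ 2) / (q ^ 2 + (1 - meanCos θ ^ 2)))))
        ∂torusMeasure d := by
    have h2 := norm_integral_le_integral_norm (μ := torusMeasure d)
      (fun θ => charSum P Y θ (l + m + 1) * latticeChar θ (-w))
    rw [fourier_inversion hY, Complex.norm_real, Real.norm_of_nonneg (by positivity)] at h2
    refine h2.trans (integral_mono_of_nonneg (Eventually.of_forall fun _ => norm_nonneg _) ?_
      (Eventually.of_forall fun θ => ?_))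
    · refine (integrable_torusMeasure ?_ 1 fun θ => ?_).const_mul _
      · have := continuous_meanCos (d := d)
        refine Real.continuous_exp.comp (Continuous.neg (continuous_const.mul
          (Continuous.div (by fun_prop) (by fun_prop) fun θ => ?_)))
        have := sub_nonneg.2 (meanCos_sq_le_one hd θ)
        positivity
      · rw [Real.norm_of_nonneg (Real.exp_pos _).le, Real.exp_le_one_iff]
        have := sub_nonneg.2 (meanCos_sq_le_one hd θ)
        have : 0 ≤ b * m * (q * (1 - meanCos θ ^ 2) / (q ^ 2 + (1 - meanCos θ ^ 2))) := by
          positivity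
        linarith
    · beta_reduce
      rw [norm_mul, norm_latticeChar, mul_one]
      refine (norm_charSum_le hd hp hY hq hqp θ).trans (le_of_eq ?_)
      rw [mul_right_comm b]
  rw [integral_const_mul] at h1
  have h3 := mul_le_mul_of_nonneg_left
    (integral_exp_rate_le hd (y := b * m) (q := q) (by positivity) hq) hA0.le
  have h4 : (Real.pi ^ 3 * d * (q / (b * m))) ^ ((d : ℝ) / 2) =
      (Real.pi ^ 3 * d / b) ^ ((d : ℝ) / 2) * (q / m) ^ ((d : ℝ) / 2) := by
    rw [← Real.mul_rpow (by positivity) (by positivity)]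
    congr 1
    field_simp
  have h5 : b * m * q / 2 = b / 2 * (m * q) := by ring
  rw [h4, h5] at h3
  have h6 := h1.trans h3
  rw [mul_comm T, ← le_div_iff₀ hT0] at h6
  refine h6.trans (le_of_eq_of_le ?_ (le_add_of_nonneg_right (a :=
    A * Real.exp (-(b / 2 * (m * q))) + A * B / T * (q / m) ^ ((d : ℝ) / 2))
    (b := A * (q / m) ^ ((d : ℝ) / 2) + A * B / T * Real.exp (-(b / 2 * (m * q))))
    (by positivity)) |>.trans (le_of_eq ?_))
  · rw [hB]
    field_simp
    rw [hT]
    ring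
  · ring

end Inversion

/-! ### Windows of update rates and Borel–Cantelli. -/

section Windows

lemma windowMin_le (p : ℕ → ℝ) (a : ℝ) {n k : ℕ} (hk : k ≤ ⌊(n : ℝ) ^ a⌋₊) :
    windowMin p a n ≤ p (n - k) :=
  Finset.inf'_le (fun k => p (n - k)) (Finset.mem_range.2 (Nat.lt_succ_of_le hk))

lemma le_windowMax (p : ℕ → ℝ) (a : ℝ) {n k : ℕ} (hk : k ≤ ⌊(n : ℝ) ^ a⌋₊) :
    p (n - k) ≤ windowMax p a n :=
  Finset.le_sup' (fun k => p (n - k)) (Finset.mem_range.2 (Nat.lt_succ_of_le hk))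

/-- In [0, ∞] a positive number divided by 0 is ∞, so a finite ratio forces a positive minimum; p n
> 0 makes the numerator positive. -/
lemma windowMin_pos_of_ratio_lt {p : ℕ → ℝ} {a r : ℝ} {n : ℕ} (hr : 0 < r) (hpn : 0 < p n)
    (h : ENNReal.ofReal (windowMax p a n) / ENNReal.ofReal (windowMin p a n) < ENNReal.ofReal r) :
    0 < windowMin p a n ∧ windowMax p a n ≤ r * windowMin p a n := by
  have hmax : 0 < windowMax p a n :=
    hpn.trans_le (by simpa using le_windowMax p a (n := n) (Nat.zero_le _))
  have hmin : 0 < windowMin p a n := by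
    by_contra hneg
    rw [ENNReal.ofReal_of_nonpos (not_lt.1 hneg),
      ENNReal.div_zero (ENNReal.ofReal_pos.2 hmax).ne'] at h
    exact not_top_lt h
  refine ⟨hmin, ?_⟩
  rw [← ENNReal.ofReal_div_of_pos hmin, ENNReal.ofReal_lt_ofReal_iff hr, div_lt_iff₀ hmin] at h
  exact h.le

end Windows

lemma finite_latticeNorm_le {d : ℕ} (R : ℝ) : {x : Fin d → ℤ | latticeNorm x ≤ R}.Finite := by
  refine (Set.finite_Icc (fun _ : Fin d => -⌈R⌉) (fun _ => ⌈R⌉)).subset fun x hx => ?_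
  have h : ∀ i, |(x i : ℝ)| ≤ ⌈R⌉ := fun i =>
    (PiLp.norm_apply_le (WithLp.toLp 2 fun i => (x i : ℝ) : EuclideanSpace ℝ (Fin d)) i).trans
      (le_trans hx (Int.le_ceil R))
  exact ⟨fun i => by exact_mod_cast (abs_le.1 (h i)).1, fun i => by exact_mod_cast (abs_le.1 (h i)).2⟩

/-- Borel–Cantelli for each of the countably many points; a ball contains finitely many of them, so
it is eventually left for good. -/
lemma stronglyTransient_of_tsum_lt_top {d : ℕ} {Ω : Type*} [MeasurableSpace Ω]
    {P : Measure Ω} {S : ℕ → Ω → (Fin d → ℤ)}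
    (h : ∀ w, ∑' n : ℕ, P {ω | S (n + 1) ω = w} < ∞) : StronglyTransient P S := by
  have h1 : ∀ᵐ ω ∂P, ∀ w, ∀ᶠ n in atTop, S (n + 1) ω ≠ w :=
    ae_all_iff.2 fun w => ae_eventually_notMem (h w).ne
  filter_upwards [h1] with ω hω
  rw [← tendsto_add_atTop_iff_nat 1, tendsto_atTop]
  intro R
  filter_upwards [(eventually_all_finite (finite_latticeNorm_le R)).2 fun w _ => hω w] with n hn
  by_contra hlt
  exact hn _ (not_le.1 hlt).le rfl

/-! ### Summability under the three conditions. -/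

section Summability

variable {d : ℕ} {p : ℕ → ℝ} {Ω : Type*} [MeasurableSpace Ω] {P : Measure Ω}
  [IsProbabilityMeasure P] {Y : ℕ → Ω → (Fin d → ℤ)}

lemma eventually_measureReal_walk_le (hd : 0 < d) (hp : ∀ n, 1 ≤ n → 0 ≤ p n ∧ p n ≤ 1)
    (hY : IsConservativeStepChain d p P Y) {ε ε' r : ℝ} (hε' : 0 < ε') (hεε' : ε' < ε) (hr : 1 < r)
    (hU : UpdateConditions d p ε ε' r) :
    ∃ C : ℝ, ∀ᶠ n : ℕ in atTop, ∀ w : Fin d → ℤ, P.real {ω | conservativeWalk Y n ω = w} ≤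
      C * (((n : ℝ) ^ (2 : ℝ))⁻¹ +
        (2 : ℝ) ^ ((d : ℝ) / 2) * (p n / (n : ℝ) ^ (1 - ε)) ^ ((d : ℝ) / 2)) := by
  obtain ⟨C, c, hC, hc, hbound⟩ := exists_measureReal_walk_le hd r
  refine ⟨C, ?_⟩
  have hr0 : 0 < r := by linarith
  -- The threshold 4r/c is chosen so that, after p n · n^{1-ε} ≤ 2r·mq, one gets c·mq ≥ 2 log n and
  -- hence the bound n⁻².
  filter_upwards [eventually_lt_of_limsup_lt hU.roughly_constant,
    hU.not_too_small.eventually_ge_atTop (max 1 (4 * r / c)), eventually_ge_atTop 3] with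
    n hratio hlarge hn3 w
  have hn3' : (3 : ℝ) ≤ n := by exact_mod_cast hn3
  have hn0 : (0 : ℝ) < n := by linarith
  obtain ⟨hp0, hp1⟩ := hp n (by omega)
  have hlog : 1 ≤ Real.log n := by
    rw [Real.le_log_iff_exp_le hn0]
    exact (Real.exp_one_lt_three.le).trans hn3'
  set x := (n : ℝ) ^ (1 - ε) with hx
  have hx0 : 0 < x := Real.rpow_pos_of_pos hn0 _
  rw [le_div_iff₀ (by linarith)] at hlarge
  have hpx1 : 1 ≤ p n * x := by nlinarith [le_max_left 1 (4 * r / c)]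
  have hpx2 : 4 * r / c * Real.log n ≤ p n * x :=
    (mul_le_mul_of_nonneg_right (le_max_right _ _) (by linarith)).trans hlarge
  have hpn : 0 < p n := by
    rcases hp0.eq_or_lt with h | h
    · rw [← h, zero_mul] at hpx1; linarith
    · exact h
  -- As p n ≤ 1, the second condition itself forces n^{1-ε} ≥ 1, so the window is nonempty without
  -- assuming ε ≤ 1.
  have hx1 : 1 ≤ x := by nlinarith
  obtain ⟨hq, hmax⟩ := windowMin_pos_of_ratio_lt hr0 hpn hratio
  set q := windowMin p (1 - ε') n with hqdef
  set X := (n : ℝ) ^ (1 - ε') with hX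
  have hxX : x ≤ X := Real.rpow_le_rpow_of_exponent_le (by linarith) (by linarith)
  set m := ⌊X⌋₊ with hm
  have hXn : X < n := by
    calc X < (n : ℝ) ^ (1 : ℝ) := Real.rpow_lt_rpow_of_exponent_lt (by linarith) (by linarith)
      _ = n := Real.rpow_one _
  have hm1 : 1 ≤ m := Nat.le_floor (by simpa using hx1.trans hxX)
  have hm1' : (1 : ℝ) ≤ m := by exact_mod_cast hm1
  have hmn : m < n := (Nat.floor_lt (by linarith)).2 hXn
  have hmx : x / 2 ≤ m := by
    have := Nat.lt_floor_add_one X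
    rw [← hm] at this
    linarith
  have hqp : q ≤ p n := by simpa using windowMin_le p (1 - ε') (n := n) (Nat.zero_le _)
  have hpq : p n ≤ r * q :=
    le_trans (by simpa using le_windowMax p (1 - ε') (n := n) (Nat.zero_le _)) hmax
  -- The m transitions leading to time n use the rates at n - m, …, n - 1, all inside the window.
  have hmain := hbound p Ω P Y hp hY q (n - 1 - m) m hq hm1 (fun k hk1 hk2 => by
    have hk : n - (n - k) = k := by omega
    have hkm : n - k ≤ ⌊(n : ℝ) ^ (1 - ε')⌋₊ := by rw [← hX, ← hm]; omega
    have h1 := windowMin_le p (1 - ε') hkm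
    have h2 := le_windowMax p (1 - ε') hkm
    rw [hk] at h1 h2
    exact ⟨h1, h2.trans hmax⟩) w
  rw [show n - 1 - m + m + 1 = n by omega] at hmain
  refine hmain.trans (mul_le_mul_of_nonneg_left (add_le_add ?_ ?_) hC.le)
  · rw [← Real.rpow_neg hn0.le, Real.rpow_def_of_pos hn0]
    refine Real.exp_le_exp.2 ?_
    have h1 : p n * x ≤ 2 * r * (m * q) := by
      calc p n * x ≤ (r * q) * (2 * m) := mul_le_mul hpq (by linarith) hx0.le (by positivity)
        _ = 2 * r * (m * q) := by ring
    have h2 : 4 * r * Real.log n ≤ 2 * r * (m * q) * c := by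
      have := mul_le_mul_of_nonneg_right (hpx2.trans h1) hc.le
      rwa [show 4 * r / c * Real.log n * c = 4 * r * Real.log n by field_simp] at this
    nlinarith
  · rw [← Real.mul_rpow (by norm_num) (by positivity)]
    refine Real.rpow_le_rpow (by positivity) ?_ (by positivity)
    rw [div_le_iff₀ (by linarith)]
    calc q ≤ p n := hqp
      _ = 2 * (p n / x) * (x / 2) := by field_simp
      _ ≤ 2 * (p n / x) * m := mul_le_mul_of_nonneg_left hmx (by positivity)

lemma summable_measureReal_walk (hd : 0 < d) (hp : ∀ n, 1 ≤ n → 0 ≤ p n ∧ p n ≤ 1)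
    (hY : IsConservativeStepChain d p P Y) {ε ε' r : ℝ} (hε' : 0 < ε') (hεε' : ε' < ε) (hr : 1 < r)
    (hU : UpdateConditions d p ε ε' r) (w : Fin d → ℤ) :
    Summable fun n : ℕ => P.real {ω | conservativeWalk Y (n + 1) ω = w} := by
  obtain ⟨C, hC⟩ := eventually_measureReal_walk_le hd hp hY hε' hεε' hr hU
  have h1 : Summable fun n : ℕ => (((n + 1 : ℕ) : ℝ) ^ (2 : ℝ))⁻¹ :=
    (summable_nat_add_iff 1).2 (Real.summable_nat_rpow_inv.2 (by norm_num : (1 : ℝ) < 2))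
  refine Summable.of_norm_bounded_eventually_nat
    ((h1.add (hU.summable.mul_left ((2 : ℝ) ^ ((d : ℝ) / 2)))).mul_left C) ?_
  filter_upwards [(tendsto_add_atTop_nat 1).eventually hC] with n hn
  rw [Real.norm_of_nonneg measureReal_nonneg]
  exact hn w

lemma tsum_lt_top_and_stronglyTransient (hd : 0 < d) (hp : ∀ n, 1 ≤ n → 0 ≤ p n ∧ p n ≤ 1)
    (hY : IsConservativeStepChain d p P Y) {ε ε' r : ℝ} (hε' : 0 < ε') (hεε' : ε' < ε) (hr : 1 < r)
    (hU : UpdateConditions d p ε ε' r) :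
    (∀ w : Fin d → ℤ, ∑' n : ℕ, P {ω | conservativeWalk Y (n + 1) ω = w} < ∞) ∧
      StronglyTransient P (conservativeWalk Y) := by
  have h : ∀ w : Fin d → ℤ, ∑' n : ℕ, P {ω | conservativeWalk Y (n + 1) ω = w} < ∞ := by
    intro w
    have hs := summable_measureReal_walk hd hp hY hε' hεε' hr hU w
    have h1 : ∀ n : ℕ, P {ω | conservativeWalk Y (n + 1) ω = w} =
        ENNReal.ofReal (P.real {ω | conservativeWalk Y (n + 1) ω = w}) := fun n =>
      (ofReal_measureReal).symm
    simp only [h1]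
    rw [← ENNReal.ofReal_tsum_of_nonneg (fun _ => measureReal_nonneg) hs]
    exact ENNReal.ofReal_lt_top
  exact ⟨h, stronglyTransient_of_tsum_lt_top h⟩

end Summability

/-! ### Power-law update rates. -/

section PowerLaw

variable {d : ℕ} {p : ℕ → ℝ} {c γ : ℝ}

lemma eventually_power_law_bounds (hc : 0 < c)
    (h : Tendsto (fun n : ℕ => p n * (n : ℝ) ^ γ) atTop (𝓝 c)) {s : ℝ} (hs : 1 < s) :
    ∀ᶠ n : ℕ in atTop, c / s * (n : ℝ) ^ (-γ) ≤ p n ∧ p n ≤ c * s * (n : ℝ) ^ (-γ) := by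
  have h1 : c / s < c := div_lt_self hc hs
  have h2 : c < c * s := lt_mul_of_one_lt_right hc hs
  filter_upwards [h.eventually_const_lt h1, h.eventually_lt_const h2, eventually_ge_atTop 1] with
    n hn1 hn2 hn
  have hn0 : (0 : ℝ) < n := by exact_mod_cast hn
  have hpow : 0 < (n : ℝ) ^ γ := Real.rpow_pos_of_pos hn0 _
  rw [Real.rpow_neg hn0.le, ← div_eq_mul_inv, ← div_eq_mul_inv, div_le_iff₀ hpow, le_div_iff₀ hpow]
  exact ⟨hn1.le, hn2.le⟩

/-- The window has length o(n), so n - k ≥ n/s throughout it, and n^{-γ} varies by at most s^γ ≤ s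
there. -/
lemma eventually_window_ratio_le (hc : 0 < c) (hγ0 : 0 < γ) (hγ1 : γ < 1)
    (h : Tendsto (fun n : ℕ => p n * (n : ℝ) ^ γ) atTop (𝓝 c)) {ε' s : ℝ} (hε' : 0 < ε')
    (hs : 1 < s) :
    ∀ᶠ n : ℕ in atTop, ENNReal.ofReal (windowMax p (1 - ε') n) /
      ENNReal.ofReal (windowMin p (1 - ε') n) ≤ ENNReal.ofReal (s ^ 4) := by
  have hs0 : 0 < s := by linarith
  obtain ⟨N, hN⟩ := eventually_atTop.1 (eventually_power_law_bounds hc h hs)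
  have hgap : 0 < 1 - s⁻¹ := sub_pos.2 (inv_lt_one_of_one_lt₀ hs)
  have hpow : ∀ᶠ n : ℕ in atTop, (n : ℝ) ^ (-ε') < 1 - s⁻¹ :=
    ((tendsto_rpow_neg_atTop hε').comp tendsto_natCast_atTop_atTop).eventually_lt_const hgap
  filter_upwards [hpow, eventually_ge_atTop (⌈s * N⌉₊), eventually_ge_atTop 1] with n hn1 hn2 hn
  have hn0 : (0 : ℝ) < n := by exact_mod_cast hn
  have hX : (n : ℝ) ^ (1 - ε') ≤ (1 - s⁻¹) * n := by
    rw [sub_eq_add_neg, add_comm, Real.rpow_add hn0, Real.rpow_one]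
    exact mul_le_mul_of_nonneg_right hn1.le hn0.le
  have hnpow : 0 < (n : ℝ) ^ (-γ) := Real.rpow_pos_of_pos hn0 _
  have key : ∀ k ≤ ⌊(n : ℝ) ^ (1 - ε')⌋₊, c / s * (n : ℝ) ^ (-γ) ≤ p (n - k) ∧
      p (n - k) ≤ c * s ^ 2 * (n : ℝ) ^ (-γ) := by
    intro k hk
    have hkX : (k : ℝ) ≤ (n : ℝ) ^ (1 - ε') := (Nat.le_floor_iff (by positivity)).1 hk
    have hkn : (k : ℝ) ≤ n := by
      have : 0 < s⁻¹ * n := by positivity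
      linarith
    have hcast : ((n - k : ℕ) : ℝ) = n - k := Nat.cast_sub (by exact_mod_cast hkn)
    have hlow : s⁻¹ * n ≤ ((n - k : ℕ) : ℝ) := by rw [hcast]; linarith
    have hpos : 0 < ((n - k : ℕ) : ℝ) := lt_of_lt_of_le (by positivity) hlow
    have hle : ((n - k : ℕ) : ℝ) ≤ n := by exact_mod_cast Nat.sub_le n k
    have hNk : N ≤ n - k := by
      have h1 : s * N ≤ n := Nat.ceil_le.1 hn2
      have h2 : (N : ℝ) ≤ s⁻¹ * n := by rwa [le_inv_mul_iff₀ hs0]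
      exact_mod_cast h2.trans hlow
    obtain ⟨b1, b2⟩ := hN _ hNk
    refine ⟨le_trans ?_ b1, b2.trans ?_⟩
    · exact mul_le_mul_of_nonneg_left
        (Real.rpow_le_rpow_of_nonpos hpos hle (by linarith)) (by positivity)
    · have h3 : ((n - k : ℕ) : ℝ) ^ (-γ) ≤ s * (n : ℝ) ^ (-γ) := by
        calc ((n - k : ℕ) : ℝ) ^ (-γ) ≤ (s⁻¹ * n) ^ (-γ) :=
              Real.rpow_le_rpow_of_nonpos (by positivity) hlow (by linarith)
          _ = s ^ γ * (n : ℝ) ^ (-γ) := by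
              rw [Real.mul_rpow (by positivity) hn0.le, Real.rpow_neg (by positivity),
                Real.inv_rpow hs0.le, inv_inv]
          _ ≤ s ^ (1 : ℝ) * (n : ℝ) ^ (-γ) := mul_le_mul_of_nonneg_right
              (Real.rpow_le_rpow_of_exponent_le hs.le hγ1.le) hnpow.le
          _ = s * (n : ℝ) ^ (-γ) := by rw [Real.rpow_one]
      calc _ ≤ c * s * (s * (n : ℝ) ^ (-γ)) := mul_le_mul_of_nonneg_left h3 (by positivity)
        _ = c * s ^ 2 * (n : ℝ) ^ (-γ) := by ring
  have hmax : windowMax p (1 - ε') n ≤ c * s ^ 2 * (n : ℝ) ^ (-γ) :=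
    Finset.sup'_le _ _ fun k hk => (key k (Nat.lt_succ_iff.1 (Finset.mem_range.1 hk))).2
  have hmin : c / s * (n : ℝ) ^ (-γ) ≤ windowMin p (1 - ε') n :=
    Finset.le_inf' _ _ fun k hk => (key k (Nat.lt_succ_iff.1 (Finset.mem_range.1 hk))).1
  refine ENNReal.div_le_of_le_mul ?_
  rw [← ENNReal.ofReal_mul (by positivity)]
  refine ENNReal.ofReal_le_ofReal (hmax.trans ?_)
  -- The bounds give the ratio s³; the extra factor s is slack.
  calc c * s ^ 2 * (n : ℝ) ^ (-γ) ≤ s * (c * s ^ 2 * (n : ℝ) ^ (-γ)) :=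
        le_mul_of_one_le_left (by positivity) hs.le
    _ = s ^ 4 * (c / s * (n : ℝ) ^ (-γ)) := by field_simp
    _ ≤ _ := mul_le_mul_of_nonneg_left hmin (by positivity)

lemma exists_one_lt_pow_four_lt {r : ℝ} (hr : 1 < r) : ∃ s : ℝ, 1 < s ∧ s ^ 4 < r := by
  have hcont : Tendsto (fun s : ℝ => s ^ 4) (𝓝[>] 1) (𝓝 (1 ^ 4)) :=
    ((continuous_pow 4).tendsto 1).mono_left nhdsWithin_le_nhds
  obtain ⟨s, h1, h2⟩ := ((hcont.eventually_lt_const (by rwa [one_pow])).and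
    self_mem_nhdsWithin).exists
  exact ⟨s, h2, h1⟩

lemma tendsto_rpow_div_log_natCast {a : ℝ} (ha : 0 < a) :
    Tendsto (fun n : ℕ => (n : ℝ) ^ a / Real.log n) atTop atTop := by
  have h : Tendsto (fun x : ℝ => Real.log x / x ^ a) atTop (𝓝[>] 0) := by
    refine tendsto_nhdsWithin_iff.2 ⟨(isLittleO_log_rpow_atTop ha).tendsto_div_nhds_zero, ?_⟩
    filter_upwards [eventually_gt_atTop 1] with x hx
    exact div_pos (Real.log_pos hx) (Real.rpow_pos_of_pos (by linarith) _)
  have h2 := h.inv_tendsto_nhdsGT_zero.comp tendsto_natCast_atTop_atTop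
  refine h2.congr fun n => ?_
  simp

lemma updateConditions_of_power_law (hd : 2 ≤ d) (hp : ∀ n, 1 ≤ n → 0 ≤ p n ∧ p n ≤ 1)
    (hc : 0 < c) (hγ0 : 0 < γ) (hγ1 : γ < 1)
    (h : Tendsto (fun n : ℕ => p n * (n : ℝ) ^ γ) atTop (𝓝 c)) {ε ε' r : ℝ} (hε' : 0 < ε')
    (hε : ε < min γ (1 - γ)) (hr : 1 < r) : UpdateConditions d p ε ε' r := by
  obtain ⟨hεγ, hεγ'⟩ := lt_min_iff.1 hε
  refine ⟨?_, ?_, ?_⟩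
  · obtain ⟨s, hs1, hs⟩ := exists_one_lt_pow_four_lt hr
    exact (limsup_le_of_le (h := eventually_window_ratio_le hc hγ0 hγ1 h hε' hs1)).trans_lt
      ((ENNReal.ofReal_lt_ofReal_iff (by linarith)).2 hs)
  -- Factor the quantity as (p n · n^γ) · n^{1-ε-γ}/log n; the exponent is positive because ε < 1 -
  -- γ.
  · refine (h.pos_mul_atTop hc
      (tendsto_rpow_div_log_natCast (a := 1 - ε - γ) (by linarith))).congr' ?_
    filter_upwards [eventually_ge_atTop 1] with n hn
    have hn0 : (0 : ℝ) < n := by exact_mod_cast hn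
    rw [mul_div_assoc', mul_assoc, ← Real.rpow_add hn0]
    congr 3
    ring
  · have hd2 : (1 : ℝ) ≤ (d : ℝ) / 2 := by
      have : (2 : ℝ) ≤ d := by exact_mod_cast hd
      linarith
    -- This is where ε < γ and d ≥ 2 enter.
    have hexp : 1 < (γ + (1 - ε)) * ((d : ℝ) / 2) := by nlinarith
    have h1 : Summable fun n : ℕ => (((n + 1 : ℕ) : ℝ) ^ ((γ + (1 - ε)) * ((d : ℝ) / 2)))⁻¹ :=
      (summable_nat_add_iff 1).2 (Real.summable_nat_rpow_inv.2 hexp)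
    refine Summable.of_norm_bounded_eventually_nat (h1.mul_left ((c * 2) ^ ((d : ℝ) / 2))) ?_
    filter_upwards [(tendsto_add_atTop_nat 1).eventually
      (eventually_power_law_bounds hc h one_lt_two)] with n hn
    have hn0 : (0 : ℝ) < ((n + 1 : ℕ) : ℝ) := by positivity
    have hp0 := (hp (n + 1) (by omega)).1
    rw [Real.norm_of_nonneg (by positivity), ← Real.rpow_neg hn0.le, ← neg_mul,
      Real.rpow_mul hn0.le, ← Real.mul_rpow (by positivity) (by positivity)]
    refine Real.rpow_le_rpow (by positivity) ?_ (by positivity)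
    rw [neg_add, Real.rpow_add hn0, Real.rpow_neg hn0.le (1 - ε), ← mul_assoc, ← div_eq_mul_inv]
    exact div_le_div_of_nonneg_right hn.2 (by positivity)

end PowerLaw

theorem theorem7 (d : ℕ) (hd : 2 ≤ d) (p : ℕ → ℝ)
    (hp : ∀ n, 1 ≤ n → 0 ≤ p n ∧ p n ≤ 1)
    {Ω : Type*} [MeasurableSpace Ω] (P : Measure Ω) [IsProbabilityMeasure P]
    (Y : ℕ → Ω → (Fin d → ℤ)) (hY : IsConservativeStepChain d p P Y) :
    (∀ ε ε' r : ℝ, 0 < ε' → ε' < ε → 1 < r → UpdateConditions d p ε ε' r →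
      (∀ w : Fin d → ℤ, ∑' n : ℕ, P {ω | conservativeWalk Y (n + 1) ω = w} < ∞) ∧
        StronglyTransient P (conservativeWalk Y)) ∧
    (∀ c γ : ℝ, 0 < c → 0 < γ → γ < 1 →
      Tendsto (fun n : ℕ => p n * (n : ℝ) ^ γ) atTop (𝓝 c) →
      (∀ ε ε' r : ℝ, 0 < ε' → ε' < ε → ε < min γ (1 - γ) → 1 < r →
        UpdateConditions d p ε ε' r) ∧
      (∀ w : Fin d → ℤ, ∑' n : ℕ, P {ω | conservativeWalk Y (n + 1) ω = w} < ∞) ∧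
        StronglyTransient P (conservativeWalk Y)) := by
  have hd0 : 0 < d := by omega
  refine ⟨fun ε ε' r hε' hεε' hr hU =>
    tsum_lt_top_and_stronglyTransient hd0 hp hY hε' hεε' hr hU, ?_⟩
  intro c γ hc hγ0 hγ1 h
  have hmin : 0 < min γ (1 - γ) := lt_min hγ0 (by linarith)
  refine ⟨fun ε ε' r hε' _ hε hr =>
    updateConditions_of_power_law hd hp hc hγ0 hγ1 h hε' hε hr, ?_⟩
  exact tsum_lt_top_and_stronglyTransient hd0 hp hY (ε := min γ (1 - γ) / 2)
    (ε' := min γ (1 - γ) / 4) (r := 2) (by linarith) (by linarith) one_lt_two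
    (updateConditions_of_power_law hd hp hc hγ0 hγ1 h (by linarith) (by linarith) one_lt_two)
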